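/- Let $\kappa$ be an infinite regular cardinal or the symbol $\infty$, which is treated as greater than every cardinal and ordinal. Cardinals are identified with initial ordinals, and $0$ counts as a limit ordinal. Every ordinal is uniquely $i = i' + m$ with $i'$ a limit and $m\in\mathbb N$; call $i'$ its limit part and $m$ its finite part. **Final chain.** For a set $X$ let $\mathcal P_{<\kappa}X$ be the set of its subsets with fewer than $\kappa$ elements; $\mathcal P=\mathcal P_{<\infty}$ is the full powerset. The final chain of $\mathcal P_{<\kappa}$ consists of sets $\nu_i\mathcal P_{<\kappa}$ for all ordinals $i$ and connecting maps $\nu^j_i:\nu_i\mathcal P_{<\kappa}\to\nu_j\mathcal P_{<\kappa}$ for $j\le i$, functorial in the sense that $\nu^i_i=\mathrm{id}$ and $\nu^k_j\nu^j_i=\nu^k_i$ for $k\le j\le i$, given as follows. $\nu_{i+1}\mathcal P_{<\kappa}=\mathcal P_{<\kappa}(\nu_i\mathcal P_{<\kappa})$ and $\nu^{j+1}_{i+1}a=\{\nu^j_i b\mid b\in a\}$. For a limit $i$, $\nu_i\mathcal P_{<\kappa}$ is the set of families $(x_j)_{j<i}$ with $x_j\in\nu_j\mathcal P_{<\kappa}$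 and $\nu^k_j x_j=x_k$ for $k\le j<i$, and $\nu^j_i$ is the $j$-th component map for $j<i$. We have $\nu_i\mathcal P_{<\kappa}\subseteq\nu_i\mathcal P$. **Transition system.** The elements of all the sets $\nu_i\mathcal P$ form a transition system: the successors of $a\in\nu_{i+1}\mathcal P$ are its elements $b\in\nu_i\mathcal P$; for a limit $i$, the successors of $a\in\nu_i\mathcal P$ are the $b\in\nu_i\mathcal P$ such that $b_j\in a_{j+1}$ for all $j<i$. **Coalgebra projections.** For an element $x$ of a transition system define $p_j(x)\in\nu_j\mathcal P$ by $p_{j+1}(x)=\{p_j(y)\mid y\text{ a successor of }x\}$ and, for a limit $j$, $p_j(x)=(p_k(x))_{k<j}$. **Extensible limits.** Let $\lambda$ be an infinite regular cardinal. A tidy $\lambda$-tree is a functor $D$ from $\lambda^{\mathrm{op}}$ to sets with all connecting maps $D_i\to D_j$ ($j\le i<\lambda$) surjective, with $D_0\neq\emptyset$, and such that, for each limit $i<\lambda$, an element of $D_i$ is determined by its images in all $D_j$, $j<i$. $\lambda$ has the tree property if every tidy $\lambda$-tree with $|D_i|<\lambda$ for all $i$ has a full branch, i.e. a family $(x_i)_{i<\lambda}$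 with $x_i\in D_i$ and $x_i\mapsto x_j$ for $j\le i$. $\lambda$ is weakly compact if it has the tree property and $|\mathcal P A|<\lambda$ whenever $|A|<\lambda$ (so $\aleph_0$ is weakly compact). A limit ordinal is $\kappa$-extensible if it is $0$, or the supremum of a strictly increasing sequence $(i_n)_{n\in\mathbb N}$ of ordinals, or a weakly compact cardinal, or, in case $\kappa<\infty$, either $\ge\kappa+\omega$, or equal to $\kappa$ where $\kappa$ has the tree property. **Theorem.** For all ordinals $j\le i$ the following are equivalent: 1. for every $a\in\nu_i\mathcal P_{<\kappa}$, regarded as an element of the above transition system, $p_j(a)=\nu^j_i a$; 2. either $j$ is at most the finite part of $i$, or the limit part of $i$ is $\kappa$-extensible. -/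

import Mathlib

open Order Cardinal Ordinal

universe u v w

/-! Throughout, `0` counts as a limit ordinal, so "limit" is Mathlib's `Order.IsSuccPrelimit`. -/

/-! ## Inverse chains, tidy trees and properties of ordinals -/

/-- An inverse `I`-chain: a contravariant functor from the ordered set `I` to sets. -/
structure InverseChain (I : Type w) [Preorder I] where
  obj : I → Type v
  map : ∀ {j i : I}, j ≤ i → obj i → obj j
  map_id : ∀ (i : I) (x : obj i), map (le_refl i) x = x
  map_comp : ∀ {k j i : I} (hkj : k ≤ j) (hji : j ≤ i) (x : obj i),
    map hkj (map hji x) = map (hkj.trans hji) x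

/-- A full branch of an inverse chain: a compatible family of elements, one on every level. -/
def InverseChain.IsFullBranch {I : Type w} [Preorder I] (D : InverseChain.{v} I)
    (x : ∀ i, D.obj i) : Prop :=
  ∀ (j i : I) (h : j ≤ i), D.map h (x i) = x j

/-- A tidy tree: all connecting maps are surjective, a full branch below a limit level has at most
one extension to that level, and the least level is inhabited. -/
structure InverseChain.IsTidy {I : Type w} [LinearOrder I] (D : InverseChain.{v} I) : Prop where
  surjective : ∀ (j i : I) (h : j ≤ i), Function.Surjective (D.map h)
  limit_unique : ∀ i : I, IsSuccPrelimit i → ∀ x y : D.obj i,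
    (∀ (j : I) (h : j < i), D.map h.le x = D.map h.le y) → x = y
  root : ∃ i : I, IsBot i ∧ Nonempty (D.obj i)

/-- The tree property: every tidy `c`-tree whose levels have size `< c` has a full branch. -/
def HasTreeProperty (c : Cardinal.{u}) : Prop :=
  ∀ D : InverseChain.{u} (Set.Iio c.ord), D.IsTidy → (∀ i, #(D.obj i) < c) →
    ∃ x, D.IsFullBranch x

/-- Strong inaccessibility of a regular infinite cardinal, where `ℵ₀` is allowed. -/
def IsStronglyInaccessible (c : Cardinal.{u}) : Prop :=
  c.IsRegular ∧ ∀ A : Type u, #A < c → #(Set A) < c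

/-- Weakly compact cardinals, where `ℵ₀` is allowed. -/
def IsWeaklyCompact (c : Cardinal.{u}) : Prop :=
  IsStronglyInaccessible c ∧ HasTreeProperty c

/-- An ordinal is `ω`-cofinal if it is the supremum of a strictly increasing `ℕ`-sequence. -/
def IsOmegaCofinal (i : Ordinal.{u}) : Prop :=
  ∃ f : ℕ → Ordinal.{u}, StrictMono f ∧ IsLUB (Set.range f) i

/-- `κ`-extensible limit ordinals, where `κ` is a cardinal or the symbol `⊤` that exceeds all
cardinals. A cardinal `c` is identified with its initial ordinal `c.ord`. -/
def IsExtensible (κ : WithTop Cardinal.{u}) (i : Ordinal.{u}) : Prop :=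
  IsSuccPrelimit i ∧
    (i = 0 ∨ IsOmegaCofinal i ∨ (∃ c : Cardinal.{u}, IsWeaklyCompact c ∧ i = c.ord) ∨
      (∃ c : Cardinal.{u}, κ = (c : WithTop Cardinal.{u}) ∧ c.ord + ω ≤ i) ∨
      (∃ c : Cardinal.{u}, κ = (c : WithTop Cardinal.{u}) ∧ HasTreeProperty c ∧ i = c.ord))

/-- `κ` is infinite and regular; `⊤` is deemed to be so. -/
def IsInfiniteRegular (κ : WithTop Cardinal.{u}) : Prop :=
  ∀ c : Cardinal.{u}, κ = (c : WithTop Cardinal.{u}) → c.IsRegular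

/-- The limit part `l` of `i = l + n`, where `l` is a limit and `n` is finite. -/
noncomputable def limitPart (i : Ordinal.{u}) : Ordinal.{u} := ω * (i / ω)

/-- The finite part `n` of `i = l + n`, where `l` is a limit and `n` is finite. -/
noncomputable def finitePart (i : Ordinal.{u}) : Ordinal.{u} := i % ω

theorem limitPart_add_finitePart (i : Ordinal.{u}) : limitPart i + finitePart i = i :=
  Ordinal.div_add_mod i ω

theorem isSuccPrelimit_limitPart (i : Ordinal.{u}) : IsSuccPrelimit (limitPart i) :=
  isSuccPrelimit_iff_omega0_dvd.2 (Dvd.intro _ rfl)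

theorem finitePart_lt_omega0 (i : Ordinal.{u}) : finitePart i < ω :=
  Ordinal.mod_lt i omega0_ne_zero

/-! ## The final chain

The levels of the final chain of the full powerset functor and of all its restrictions
`𝒫_{<κ}` are carved out of the types `PreLevel i`, which are formed as the levels of the final
chain except that arbitrary families (instead of full branches) are allowed at limits. -/

/-- `PreLevel (i + 1)` is the powerset of `PreLevel i`, and `PreLevel l`, for a limit `l`, is the
set of all families `(x_j)_{j < l}` with `x_j` in `PreLevel j`. -/
noncomputable def PreLevel (i : Ordinal.{u}) : Type (u + 1) :=
  SuccOrder.prelimitRecOn (motive := fun _ => Type (u + 1)) i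
    (fun _ _ X => Set X) (fun l _ X => ∀ (j : Ordinal.{u}) (h : j < l), X j h)

theorem preLevel_succ (i : Ordinal.{u}) : PreLevel (succ i) = Set (PreLevel i) :=
  SuccOrder.prelimitRecOn_succ (motive := fun _ => Type (u + 1)) _ _ i

theorem preLevel_limit (l : Ordinal.{u}) (hl : IsSuccPrelimit l) :
    PreLevel l = ∀ j : Ordinal.{u}, j < l → PreLevel j :=
  SuccOrder.prelimitRecOn_of_isSuccPrelimit (motive := fun _ => Type (u + 1)) _ _ hl

/-- An element of `PreLevel (i + 1)`, as a set of elements of `PreLevel i`. -/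
noncomputable def PreLevel.toSet (i : Ordinal.{u}) : PreLevel (succ i) ≃ Set (PreLevel i) :=
  Equiv.cast (preLevel_succ i)

/-- An element of `PreLevel l`, for a limit `l`, as the family of its components. -/
noncomputable def PreLevel.component {l : Ordinal.{u}} (hl : IsSuccPrelimit l) :
    PreLevel l ≃ ∀ j : Ordinal.{u}, j < l → PreLevel j :=
  Equiv.cast (preLevel_limit l hl)

open Classical in
/-- The connecting map from `PreLevel i` to `PreLevel j`, for `j ≤ i`:
* if `i` is a limit, it is the identity for `j = i` and the `j`-th component for `j < i`;
* from `i + 1` to `j + 1` it is the image under the connecting map from `i` to `j`;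
* from `i + 1` to a limit `l` it is the tuple of the connecting maps from `i + 1` to all `k < l`. -/
noncomputable def preConn (i : Ordinal.{u}) :
    ∀ j : Ordinal.{u}, j ≤ i → PreLevel i → PreLevel j :=
  SuccOrder.prelimitRecOn
    (motive := fun i => ∀ j : Ordinal.{u}, j ≤ i → PreLevel i → PreLevel j) i
    (fun i _ connI j hj a =>
      SuccOrder.prelimitRecOn (motive := fun j => j ≤ succ i → PreLevel j) j
        (fun j _ _ hj =>
          (PreLevel.toSet j).symm (connI j (succ_le_succ_iff.1 hj) '' PreLevel.toSet i a))
        (fun _ hl connA hle =>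
          (PreLevel.component hl).symm fun k hk => connA k hk (hk.le.trans hle))
        hj)
    (fun _ hi _ j hj a =>
      if h : j = _ then h ▸ a else PreLevel.component hi a j (lt_of_le_of_ne hj h))

theorem preConn_succ_succ {i j : Ordinal.{u}} (h : succ j ≤ succ i) (a : PreLevel (succ i)) :
    preConn (succ i) (succ j) h a =
      (PreLevel.toSet j).symm (preConn i j (succ_le_succ_iff.1 h) '' PreLevel.toSet i a) := by
  rw [preConn, SuccOrder.prelimitRecOn_succ, SuccOrder.prelimitRecOn_succ]
  rfl

theorem preConn_succ_limit {i l : Ordinal.{u}} (hl : IsSuccPrelimit l) (h : l ≤ succ i)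
    (a : PreLevel (succ i)) :
    preConn (succ i) l h a =
      (PreLevel.component hl).symm fun k hk => preConn (succ i) k (hk.le.trans h) a := by
  have e : ∀ (k : Ordinal.{u}) (hk : k ≤ succ i), preConn (succ i) k hk a = _ := fun k hk => by
    rw [preConn, SuccOrder.prelimitRecOn_succ]
  rw [e, SuccOrder.prelimitRecOn_of_isSuccPrelimit _ _ hl]
  simp only [e]

theorem preConn_limit_self {i : Ordinal.{u}} (hi : IsSuccPrelimit i) (a : PreLevel i) :
    preConn i i le_rfl a = a := by
  rw [preConn, SuccOrder.prelimitRecOn_of_isSuccPrelimit _ _ hi, dif_pos rfl]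

theorem preConn_limit_lt {i j : Ordinal.{u}} (hi : IsSuccPrelimit i) (h : j < i)
    (a : PreLevel i) : preConn i j h.le a = PreLevel.component hi a j h := by
  rw [preConn, SuccOrder.prelimitRecOn_of_isSuccPrelimit _ _ hi, dif_neg h.ne]

/-- The set `s` has fewer than `κ` elements (no condition if `κ = ⊤`). -/
def SizeLT (κ : WithTop Cardinal.{u}) {X : Type (u + 1)} (s : Set X) : Prop :=
  ∀ c : Cardinal.{u}, κ = (c : WithTop Cardinal.{u}) → #s < Cardinal.lift.{u + 1} c

/-- The `i`-th level of the final chain of `𝒫_{<κ}`: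
* level `i + 1` consists of the subsets of level `i` with fewer than `κ` elements;
* level `l`, for a limit `l`, consists of the full branches through the levels below `l`. -/
noncomputable def level (κ : WithTop Cardinal.{u}) (i : Ordinal.{u}) : Set (PreLevel i) :=
  SuccOrder.prelimitRecOn (motive := fun i => Set (PreLevel i)) i
    (fun i _ N => {a | PreLevel.toSet i a ⊆ N ∧ SizeLT κ (PreLevel.toSet i a)})
    (fun l hl N => {a | (∀ (j : Ordinal.{u}) (hj : j < l), PreLevel.component hl a j hj ∈ N j hj) ∧
      ∀ (k j : Ordinal.{u}) (hkj : k ≤ j) (hj : j < l),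
        preConn j k hkj (PreLevel.component hl a j hj) =
          PreLevel.component hl a k (hkj.trans_lt hj)})

theorem mem_level_succ {κ : WithTop Cardinal.{u}} {i : Ordinal.{u}} {a : PreLevel (succ i)} :
    a ∈ level κ (succ i) ↔
      PreLevel.toSet i a ⊆ level κ i ∧ SizeLT κ (PreLevel.toSet i a) := by
  rw [level, SuccOrder.prelimitRecOn_succ]
  rfl

theorem mem_level_limit {κ : WithTop Cardinal.{u}} {l : Ordinal.{u}} (hl : IsSuccPrelimit l)
    {a : PreLevel l} :
    a ∈ level κ l ↔
      (∀ (j : Ordinal.{u}) (hj : j < l), PreLevel.component hl a j hj ∈ level κ j) ∧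
      ∀ (k j : Ordinal.{u}) (hkj : k ≤ j) (hj : j < l),
        preConn j k hkj (PreLevel.component hl a j hj) =
          PreLevel.component hl a k (hkj.trans_lt hj) := by
  rw [level, SuccOrder.prelimitRecOn_of_isSuccPrelimit _ _ hl]
  rfl

theorem preConn_self (i : Ordinal.{u}) : ∀ a : PreLevel i, preConn i i le_rfl a = a := by
  induction i using SuccOrder.prelimitRecOn with
  | succ i _ ih =>
    intro a
    rw [preConn_succ_succ, Equiv.symm_apply_eq]
    have : preConn i i (succ_le_succ_iff.1 le_rfl) = id := funext ih
    rw [this, Set.image_id]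
  | isSuccPrelimit i hi _ => exact preConn_limit_self hi

theorem preConn_comp (κ : WithTop Cardinal.{u}) (i : Ordinal.{u}) :
    ∀ (k j : Ordinal.{u}) (hkj : k ≤ j) (hji : j ≤ i), ∀ a ∈ level κ i,
      preConn j k hkj (preConn i j hji a) = preConn i k (hkj.trans hji) a := by
  induction i using SuccOrder.prelimitRecOn with
  | succ i _ ih =>
    intro k j hkj hji a ha
    induction j using SuccOrder.prelimitRecOn generalizing k with
    | succ j _ _ =>
      induction k using SuccOrder.prelimitRecOn with
      | succ k _ _ =>
        rw [preConn_succ_succ, preConn_succ_succ, preConn_succ_succ, Equiv.apply_symm_apply,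
          Set.image_image]
        congr 1
        refine Set.image_congr fun b hb => ih _ _ _ _ b ((mem_level_succ.1 ha).1 hb)
      | isSuccPrelimit k hk ihk =>
        rw [preConn_succ_limit hk, preConn_succ_limit hk]
        congr 1
        funext m hm
        exact ihk m hm _
    | isSuccPrelimit j hj _ =>
      rcases hkj.eq_or_lt with rfl | hlt
      · rw [preConn_self]
      · rw [preConn_limit_lt hj hlt, preConn_succ_limit hj, Equiv.apply_symm_apply]
  | isSuccPrelimit i hi _ =>
    intro k j hkj hji a ha
    rcases hji.eq_or_lt with rfl | hlt
    · rw [preConn_self]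
    · rw [preConn_limit_lt hi hlt, ((mem_level_limit hi).1 ha).2,
        preConn_limit_lt hi (hkj.trans_lt hlt)]

theorem preConn_mem (κ : WithTop Cardinal.{u}) (i : Ordinal.{u}) :
    ∀ (j : Ordinal.{u}) (hji : j ≤ i), ∀ a ∈ level κ i, preConn i j hji a ∈ level κ j := by
  induction i using SuccOrder.prelimitRecOn with
  | succ i _ ih =>
    intro j hji a ha
    induction j using SuccOrder.prelimitRecOn with
    | succ j _ _ =>
      rw [preConn_succ_succ, mem_level_succ, Equiv.apply_symm_apply]
      refine ⟨?_, fun c hc => mk_image_le.trans_lt ((mem_level_succ.1 ha).2 c hc)⟩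
      rintro _ ⟨b, hb, rfl⟩
      exact ih _ _ b ((mem_level_succ.1 ha).1 hb)
    | isSuccPrelimit j hj ihj =>
      rw [preConn_succ_limit hj, mem_level_limit hj]
      simp only [Equiv.apply_symm_apply]
      exact ⟨fun k hk => ihj k hk _, fun k m hkm hm => preConn_comp κ _ _ _ _ _ a ha⟩
  | isSuccPrelimit i hi _ =>
    intro j hji a ha
    rcases hji.eq_or_lt with rfl | hlt
    · rwa [preConn_self]
    · rw [preConn_limit_lt hi hlt]
      exact ((mem_level_limit hi).1 ha).1 _ _

/-- The final chain of `𝒫_{<κ}`, an inverse chain indexed by all ordinals. -/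
noncomputable def finalChain (κ : WithTop Cardinal.{u}) :
    InverseChain.{u + 1} Ordinal.{u} where
  obj i := level κ i
  map {j i} h a := ⟨preConn i j h a.1, preConn_mem κ i j h a.1 a.2⟩
  map_id i a := Subtype.ext (preConn_self i a.1)
  map_comp {k j i} hkj hji a := Subtype.ext (preConn_comp κ i k j hkj hji a.1 a.2)

theorem level_subset_top (κ : WithTop Cardinal.{u}) (i : Ordinal.{u}) :
    level κ i ⊆ level ⊤ i := by
  induction i using SuccOrder.prelimitRecOn with
  | succ i _ ih =>
    intro a ha
    rw [mem_level_succ] at ha ⊢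
    exact ⟨ha.1.trans ih, fun c hc => (WithTop.coe_ne_top hc.symm).elim⟩
  | isSuccPrelimit i hi ih =>
    intro a ha
    rw [mem_level_limit hi] at ha ⊢
    exact ⟨fun j hj => ih j hj (ha.1 j hj), ha.2⟩

/-- Every level of the final chain of `𝒫_{<κ}` is a subset of that of `𝒫`. -/
def finalChainInclusion (κ : WithTop Cardinal.{u}) (i : Ordinal.{u})
    (a : (finalChain κ).obj i) : (finalChain ⊤).obj i :=
  ⟨a.1, level_subset_top κ i a.2⟩

/-! ## The final chain of `𝒫` as a transition system, and coalgebra projections -/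

/-- The states of the final chain of `𝒫`, seen as a transition system: the elements of all
levels. -/
def FinalChainState : Type (u + 1) :=
  Σ i : Ordinal.{u}, (finalChain.{u} ⊤).obj i

/-- The transition relation: the successors of `a` on level `i + 1` are its elements, and the
successors of `a` on a limit level `i` are the `b` on level `i` with `b_j ∈ a_{j+1}` for all
`j < i`. -/
inductive FinalChainTrans : FinalChainState.{u} → FinalChainState.{u} → Prop
  | succ (i : Ordinal.{u}) (a : (finalChain ⊤).obj (succ i)) (b : (finalChain ⊤).obj i)
      (h : b.1 ∈ PreLevel.toSet i a.1) : FinalChainTrans ⟨succ i, a⟩ ⟨i, b⟩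
  | limit (i : Ordinal.{u}) (hi : IsSuccPrelimit i) (a b : (finalChain ⊤).obj i)
      (h : ∀ (j : Ordinal.{u}) (hj : j < i),
        PreLevel.component hi b.1 j hj ∈
          PreLevel.toSet j (PreLevel.component hi a.1 (Order.succ j) (hi.succ_lt hj))) :
      FinalChainTrans ⟨i, a⟩ ⟨i, b⟩

/-- The `i`-th coalgebra projection of a transition system `(X, R)`, with values in `PreLevel i`:
`p_{i+1}(x) = {p_i(y) | R x y}`, and `p_l(x) = (p_j(x))_{j < l}` for a limit `l`. -/
noncomputable def preProj {X : Type v} (R : X → X → Prop) (i : Ordinal.{u}) : X → PreLevel i :=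
  SuccOrder.prelimitRecOn (motive := fun i => X → PreLevel i) i
    (fun i _ p x => (PreLevel.toSet i).symm {b | ∃ y, R x y ∧ p y = b})
    (fun _ hl p x => (PreLevel.component hl).symm fun j hj => p j hj x)

theorem preProj_succ {X : Type v} (R : X → X → Prop) (i : Ordinal.{u}) (x : X) :
    preProj R (succ i) x = (PreLevel.toSet i).symm {b | ∃ y, R x y ∧ preProj R i y = b} := by
  rw [preProj, SuccOrder.prelimitRecOn_succ]
  rfl

theorem preProj_limit {X : Type v} (R : X → X → Prop) {l : Ordinal.{u}} (hl : IsSuccPrelimit l)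
    (x : X) : preProj R l x = (PreLevel.component hl).symm fun j _ => preProj R j x := by
  rw [preProj, SuccOrder.prelimitRecOn_of_isSuccPrelimit _ _ hl]
  rfl

theorem preConn_preProj {X : Type v} (R : X → X → Prop) (i : Ordinal.{u}) :
    ∀ (j : Ordinal.{u}) (hji : j ≤ i) (x : X), preConn i j hji (preProj R i x) = preProj R j x := by
  induction i using SuccOrder.prelimitRecOn with
  | succ i _ ih =>
    intro j hji x
    induction j using SuccOrder.prelimitRecOn with
    | succ j _ _ =>
      rw [preConn_succ_succ, preProj_succ, preProj_succ, Equiv.apply_symm_apply]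
      congr 1
      ext b
      constructor
      · rintro ⟨_, ⟨y, hy, rfl⟩, rfl⟩
        exact ⟨y, hy, (ih _ _ y).symm⟩
      · rintro ⟨y, hy, rfl⟩
        exact ⟨_, ⟨y, hy, rfl⟩, ih _ _ y⟩
    | isSuccPrelimit j hj ihj =>
      rw [preConn_succ_limit hj, preProj_limit R hj]
      congr 1
      funext k hk
      exact ihj k hk _
  | isSuccPrelimit i hi _ =>
    intro j hji x
    rcases hji.eq_or_lt with rfl | hlt
    · rw [preConn_self]
    · rw [preConn_limit_lt hi hlt, preProj_limit R hi, Equiv.apply_symm_apply]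

theorem preProj_mem {X : Type v} (R : X → X → Prop) (i : Ordinal.{u}) :
    ∀ x : X, preProj R i x ∈ level ⊤ i := by
  induction i using SuccOrder.prelimitRecOn with
  | succ i _ ih =>
    intro x
    rw [preProj_succ, mem_level_succ, Equiv.apply_symm_apply]
    refine ⟨?_, fun c hc => (WithTop.coe_ne_top hc.symm).elim⟩
    rintro _ ⟨y, _, rfl⟩
    exact ih y
  | isSuccPrelimit i hi ih =>
    intro x
    rw [preProj_limit R hi, mem_level_limit hi]
    simp only [Equiv.apply_symm_apply]
    exact ⟨fun j hj => ih j hj x, fun k j hkj _ => preConn_preProj R j k hkj x⟩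

/-- The `i`-th coalgebra projection of a transition system (that is, of a `𝒫`-coalgebra), with
values in the `i`-th level of the final chain of `𝒫`. -/
noncomputable def coalgProj {X : Type v} (R : X → X → Prop) (i : Ordinal.{u}) (x : X) :
    (finalChain.{u} ⊤).obj i :=
  ⟨preProj R i x, preProj_mem R i x⟩

/-! ## Levels -/

/-! Passing from `(i, j)` to `(i + 1, j + 1)` does not change whether the `j`-th projection agrees
with the connecting map (`projAgrees_succ`), and agreement at `j = 0` is automatic. Everything thus
reduces to limit levels `l`: agreement must hold up to `j = l` if `l` is extensible, and must fail
already at `j = 1` otherwise (`projAgrees_iff_of_limit`).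

For `a` on a limit level, the sets `a_{k+1}` form an inverse chain with surjective maps, `sect`, and
the successors of `a` are its full branches. Agreement holds if every element of every `a_{k+1}`
lies on a full branch; it fails if `a_1` is nonempty and there is no full branch at all.

Branches exist at extensible limits: by recursion along an ω-sequence; by the tree property, the
sets `a_{k+1}` having size below the cardinal in question; or, beyond `κ`, because the connecting
maps down to level `κ` are injective, so that all choices of preimages are forced
(`preConn_injOn_of_ord_le`).

For the converse, the sets of ZF with membership serve as one transition system whose projections
supply elements of the final chain. A tree of words without full branch is turned into an element
without successors (`BranchlessTree.exists_no_successor`) by coding the letters at each position as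
sets that are indistinguishable at low levels and recognized later, still below `l`
(`LetterCoding`). Two trees suffice. If `l` is a regular cardinal without the tree property, a tidy
tree witnessing this is used. If `l` is below `κ`, not ω-cofinal, and its cofinality is at most `2 ^
m` for some infinite `m < l`, the words describe finite sequences of jumps through a cofinal subset
of `l`; an infinite branch would jump infinitely often below some `d < l`. The bound `2 ^ m` allows
a letter to be spelled out in bits below `m`. If neither `l = κ` nor the bound holds, `l` is
strongly inaccessible, and the first tree applies again. -/

theorem PreLevel.ext_of_isSuccPrelimit {l : Ordinal.{u}} (hl : IsSuccPrelimit l) {a b : PreLevel l}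
    (h : ∀ (k : Ordinal.{u}) (hk : k < l), preConn l k hk.le a = preConn l k hk.le b) :
    a = b := by
  apply (PreLevel.component hl).injective
  funext k hk
  have := h k hk
  rwa [preConn_limit_lt hl hk, preConn_limit_lt hl hk] at this

instance subsingleton_preLevel_zero : Subsingleton (PreLevel (0 : Ordinal.{u})) :=
  ⟨fun _ _ => PreLevel.ext_of_isSuccPrelimit isSuccPrelimit_zero fun _ hk =>
    absurd hk not_lt_zero⟩

theorem toSet_preConn {i j : Ordinal.{u}} (h : succ j ≤ succ i) (a : PreLevel (succ i)) :
    PreLevel.toSet j (preConn (succ i) (succ j) h a) =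
      preConn i j (succ_le_succ_iff.1 h) '' PreLevel.toSet i a := by
  rw [preConn_succ_succ, Equiv.apply_symm_apply]

theorem SizeLT.image {κ : WithTop Cardinal.{u}} {X Y : Type (u + 1)} {s : Set X} (h : SizeLT κ s)
    (f : X → Y) : SizeLT κ (f '' s) :=
  fun c hc => mk_image_le.trans_lt (h c hc)

theorem sizeLT_singleton {κ : WithTop Cardinal.{u}} (hκ : IsInfiniteRegular κ)
    {X : Type (u + 1)} (x : X) : SizeLT κ {x} := fun c hc => by
  rw [mk_singleton]
  exact one_lt_aleph0.trans_le (aleph0_le_lift.2 (hκ c hc).aleph0_le)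

/-! ## Projections of states -/

theorem toSet_preProj_succ {X : Type v} (R : X → X → Prop) (i : Ordinal.{u}) (x : X) :
    PreLevel.toSet i (preProj R (succ i) x) = {b | ∃ y, R x y ∧ preProj R i y = b} := by
  rw [preProj_succ, Equiv.apply_symm_apply]

theorem preProj_mem_level {κ : WithTop Cardinal.{u}} {X : Type (u + 1)} (R : X → X → Prop) {x : X}
    (hs : SizeLT κ {y | R x y})
    (h : ∀ y, R x y → ∀ i : Ordinal.{u}, preProj R i y ∈ level κ i) (i : Ordinal.{u}) :
    preProj R i x ∈ level κ i := by
  induction i using SuccOrder.prelimitRecOn with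
  | succ i _ _ =>
    rw [mem_level_succ, toSet_preProj_succ]
    refine ⟨?_, hs.image (preProj R i)⟩
    rintro _ ⟨y, hy, rfl⟩
    exact h y hy i
  | isSuccPrelimit i hi ih =>
    rw [mem_level_limit hi, preProj_limit R hi]
    simp only [Equiv.apply_symm_apply]
    exact ⟨ih, fun k j hkj _ => preConn_preProj R j k hkj x⟩

/-! ## Successors in the final chain -/

/-- An element of a level of the final chain, as a state. -/
def FinalChainState.of (i : Ordinal.{u}) (a : PreLevel i) (ha : a ∈ level ⊤ i) :
    FinalChainState.{u} :=
  ⟨i, a, ha⟩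

theorem finalChainTrans_succ {i : Ordinal.{u}} {a : PreLevel (succ i)}
    {ha : a ∈ level ⊤ (succ i)} {s : FinalChainState.{u}} :
    FinalChainTrans (.of (succ i) a ha) s ↔
      ∃ (b : PreLevel i) (hb : b ∈ level ⊤ i), b ∈ PreLevel.toSet i a ∧ s = .of i b hb := by
  constructor
  · intro h
    generalize hx : FinalChainState.of (succ i) a ha = x at h
    cases h with
    | succ i' a' b h =>
      obtain rfl : i = i' := succ_injective (congrArg Sigma.fst hx)
      cases hx
      exact ⟨b.1, b.2, h, rfl⟩
    | limit i' hi' a' b h =>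
      obtain rfl : succ i = i' := congrArg Sigma.fst hx
      exact absurd hi' (not_isSuccPrelimit_succ i)
  · rintro ⟨b, hb, h, rfl⟩
    exact .succ i ⟨a, ha⟩ ⟨b, hb⟩ h

theorem finalChainTrans_limit {l : Ordinal.{u}} (hl : IsSuccPrelimit l)
    {a : PreLevel l} {ha : a ∈ level ⊤ l} {s : FinalChainState.{u}} :
    FinalChainTrans (.of l a ha) s ↔
      ∃ (b : PreLevel l) (hb : b ∈ level ⊤ l),
        (∀ (j : Ordinal.{u}) (hj : j < l), preConn l j hj.le b ∈
          PreLevel.toSet j (preConn l (succ j) (hl.succ_lt hj).le a)) ∧ s = .of l b hb := by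
  constructor
  · intro h
    generalize hx : FinalChainState.of l a ha = x at h
    cases h with
    | succ i' a' b h =>
      obtain rfl : l = succ i' := congrArg Sigma.fst hx
      exact absurd hl (not_isSuccPrelimit_succ i')
    | limit i' hi' a' b h =>
      obtain rfl : l = i' := congrArg Sigma.fst hx
      cases hx
      refine ⟨b.1, b.2, fun j hj => ?_, rfl⟩
      rw [preConn_limit_lt hl hj, preConn_limit_lt hl (hl.succ_lt hj)]
      exact h j hj
  · rintro ⟨b, hb, h, rfl⟩
    refine .limit l hl ⟨a, ha⟩ ⟨b, hb⟩ fun j hj => ?_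
    have := h j hj
    rwa [preConn_limit_lt hl hj, preConn_limit_lt hl (hl.succ_lt hj)] at this

/-! ## Agreement of projections with connecting maps -/

/-- On level `i` of the final chain of `𝒫_{<κ}`, the `j`-th coalgebra projection is the connecting
map to level `j`. -/
def ProjAgrees (κ : WithTop Cardinal.{u}) (i j : Ordinal.{u}) (h : j ≤ i) : Prop :=
  ∀ (a : PreLevel i) (ha : a ∈ level κ i),
    preProj FinalChainTrans j (.of i a (level_subset_top κ i ha)) = preConn i j h a

theorem coalgProj_eq_iff_projAgrees (κ : WithTop Cardinal.{u}) (i j : Ordinal.{u}) (h : j ≤ i) :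
    (∀ a : (finalChain κ).obj i,
      coalgProj FinalChainTrans j ⟨i, finalChainInclusion κ i a⟩ =
        finalChainInclusion κ j ((finalChain κ).map h a)) ↔ ProjAgrees κ i j h :=
  ⟨fun H a ha => congrArg Subtype.val (H ⟨a, ha⟩), fun H a => Subtype.ext (H a.1 a.2)⟩

theorem ProjAgrees.mono {κ : WithTop Cardinal.{u}} {i j k : Ordinal.{u}} {h : j ≤ i}
    (H : ProjAgrees κ i j h) (hk : k ≤ j) : ProjAgrees κ i k (hk.trans h) := fun a ha => by
  rw [← preConn_preProj _ j k hk, H a ha, preConn_comp κ i k j hk h a ha]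

theorem projAgrees_zero (κ : WithTop Cardinal.{u}) (i : Ordinal.{u}) :
    ProjAgrees κ i 0 zero_le := fun _ _ => Subsingleton.elim _ _

/-- Both maps act on a set elementwise, so agreement lifts to sets; conversely it is detected on
singletons, which belong to the next level because `κ` is infinite. -/
theorem projAgrees_succ {κ : WithTop Cardinal.{u}} (hκ : IsInfiniteRegular κ) {i j : Ordinal.{u}}
    (h : j ≤ i) : ProjAgrees κ (succ i) (succ j) (succ_le_succ h) ↔ ProjAgrees κ i j h := by
  constructor
  · intro H a ha
    have := congrArg (PreLevel.toSet j) (H ((PreLevel.toSet i).symm {a}) (by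
      rw [mem_level_succ, Equiv.apply_symm_apply]
      exact ⟨by simpa using ha, sizeLT_singleton hκ a⟩))
    rw [toSet_preProj_succ, toSet_preConn] at this
    simp only [finalChainTrans_succ, Equiv.apply_symm_apply, Set.image_singleton] at this
    have h2 : preProj FinalChainTrans j (.of i a (level_subset_top κ i ha)) ∈
        ({preConn i j h a} : Set _) := by
      rw [← this]
      exact ⟨_, ⟨a, level_subset_top κ i ha, rfl, rfl⟩, rfl⟩
    exact h2
  · intro H a ha
    apply (PreLevel.toSet j).injective
    rw [toSet_preProj_succ, toSet_preConn]
    ext c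
    simp only [finalChainTrans_succ, Set.mem_ofPred_eq, Set.mem_image]
    constructor
    · rintro ⟨_, ⟨b, _, hb, rfl⟩, rfl⟩
      exact ⟨b, hb, (H b ((mem_level_succ.1 ha).1 hb)).symm⟩
    · rintro ⟨b, hb, rfl⟩
      exact ⟨_, ⟨b, _, hb, rfl⟩, H b ((mem_level_succ.1 ha).1 hb)⟩

theorem projAgrees_add_natCast {κ : WithTop Cardinal.{u}} (hκ : IsInfiniteRegular κ)
    {i j : Ordinal.{u}} (h : j ≤ i) (n : ℕ) (h' : j + n ≤ i + n) :
    ProjAgrees κ (i + n) (j + n) h' ↔ ProjAgrees κ i j h := by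
  induction n with
  | zero => simp only [Nat.cast_zero, add_zero]
  | succ n ih =>
    have e : ∀ k : Ordinal.{u}, k + ((n + 1 : ℕ) : Ordinal.{u}) = succ (k + n) := fun k => by
      rw [Nat.cast_add, Nat.cast_one, ← add_assoc, succ_eq_add_one]
    simp only [e] at h' ⊢
    rw [projAgrees_succ hκ (succ_le_succ_iff.1 h'), ih]

/-- Cancelling the finite part `n` of `i` turns `j ≤ n` into the trivial index `0`, and `j > n` into
an index at least `1` on the limit level, so failure at index `1` is all that is needed. -/
theorem projAgrees_iff_of_limit {κ : WithTop Cardinal.{u}} (hκ : IsInfiniteRegular κ)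
    {Q : Ordinal.{u} → Prop}
    (hpos : ∀ l, IsSuccPrelimit l → Q l → ProjAgrees κ l l le_rfl)
    (hneg : ∀ l, IsSuccPrelimit l → ¬ Q l → l ≠ 0 ∧ ∀ h : 1 ≤ l, ¬ ProjAgrees κ l 1 h)
    (i j : Ordinal.{u}) (hji : j ≤ i) :
    ProjAgrees κ i j hji ↔ j ≤ finitePart i ∨ Q (limitPart i) := by
  obtain ⟨n, hn⟩ := lt_omega0.1 (finitePart_lt_omega0 i)
  have hi := limitPart_add_finitePart i
  have hl := isSuccPrelimit_limitPart i
  generalize limitPart i = l at hi hl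
  rw [hn] at hi ⊢
  subst hi
  constructor
  · intro H
    by_contra! hc
    obtain ⟨h0, h1⟩ := hneg l hl hc.2
    have h1l : 1 ≤ l := Order.one_le_iff_ne_zero.2 h0
    have e : (1 : Ordinal.{u}) + n ≤ j := by
      have e1 : (1 : Ordinal.{u}) + n = succ (n : Ordinal.{u}) := by
        rw [succ_eq_add_one]; exact_mod_cast Nat.add_comm 1 n
      rw [e1]
      exact succ_le_of_lt hc.1
    exact h1 h1l ((projAgrees_add_natCast hκ h1l n (e.trans hji)).1 (H.mono e))
  · rintro (hj | hQ)
    · have h0 : (0 : Ordinal.{u}) + n ≤ l + n := by simp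
      exact ((projAgrees_add_natCast hκ (zero_le) n h0).2
        (projAgrees_zero κ l)).mono (by simpa using hj)
    · exact ((projAgrees_add_natCast hκ le_rfl n le_rfl).2 (hpos l hl hQ)).mono hji

/-! ## Limit levels -/

/-- Every element of a set occurring as a component of `a` lies on a full branch. -/
def HasBranches (κ : WithTop Cardinal.{u}) {l : Ordinal.{u}} (hl : IsSuccPrelimit l)
    (a : PreLevel l) : Prop :=
  ∀ (j : Ordinal.{u}) (hj : j < l),
    ∀ x ∈ PreLevel.toSet j (preConn l (succ j) (hl.succ_lt hj).le a),
    ∃ b ∈ level κ l, preConn l j hj.le b = x ∧ ∀ (k : Ordinal.{u}) (hk : k < l),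
      preConn l k hk.le b ∈ PreLevel.toSet k (preConn l (succ k) (hl.succ_lt hk).le a)

/-- By induction on `j`, the `j`-th projection of a successor `b` is its component `b_j`. Hence the
next projection of `a` collects the elements of `a_{j+1}` that lie on full branches, which by
assumption are all of them. -/
theorem projAgrees_of_hasBranches {κ : WithTop Cardinal.{u}} {l : Ordinal.{u}}
    (hl : IsSuccPrelimit l) (H : ∀ a ∈ level κ l, HasBranches κ hl a) (j : Ordinal.{u})
    (hj : j ≤ l) : ProjAgrees κ l j hj := by
  induction j using SuccOrder.prelimitRecOn with
  | succ j _ ih =>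
    intro a ha
    have hjl : j < l := (lt_succ j).trans_le hj
    have ih := ih hjl.le
    apply (PreLevel.toSet j).injective
    rw [toSet_preProj_succ]
    ext x
    simp only [finalChainTrans_limit hl, Set.mem_ofPred_eq]
    constructor
    · rintro ⟨_, ⟨b, hbt, hb, rfl⟩, rfl⟩
      -- The induction hypothesis concerns the chain of `κ` only, but successors are taken in the
      -- full chain; `b` stays inside because its components are elements of components of `a`.
      have hbκ : b ∈ level κ l := by
        refine (mem_level_limit hl).2 ⟨fun k hk => ?_, ((mem_level_limit hl).1 hbt).2⟩
        rw [← preConn_limit_lt hl hk]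
        exact (mem_level_succ.1 (preConn_mem κ l _ (hl.succ_lt hk).le a ha)).1 (hb k hk)
      rw [ih b hbκ]
      exact hb j hjl
    · intro hx
      obtain ⟨b, hb, rfl, hbk⟩ := H a ha j hjl x hx
      exact ⟨_, ⟨b, level_subset_top κ l hb, hbk, rfl⟩, ih b hb⟩
  | isSuccPrelimit j hj' ih =>
    intro a ha
    refine PreLevel.ext_of_isSuccPrelimit hj' fun k hk => ?_
    rw [preConn_preProj, preConn_comp κ _ _ _ _ _ _ ha]
    exact ih k hk _ a ha

/-- Without successors the first projection of `a` is the empty set, whereas its first component is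
nonempty. -/
theorem not_projAgrees_one {κ : WithTop Cardinal.{u}} {l : Ordinal.{u}} (hl : IsSuccPrelimit l)
    {a : PreLevel l} (ha : a ∈ level κ l) (h0 : 0 < l)
    (hne : (PreLevel.toSet 0 (preConn l (succ 0) (hl.succ_lt h0).le a)).Nonempty)
    (hno : ∀ b ∈ level ⊤ l, ¬ ∀ (k : Ordinal.{u}) (hk : k < l),
      preConn l k hk.le b ∈ PreLevel.toSet k (preConn l (succ k) (hl.succ_lt hk).le a))
    (h : 1 ≤ l) : ¬ ProjAgrees κ l 1 h := by
  intro H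
  have := congrArg (PreLevel.toSet 0)
    (H.mono (succ_le_of_lt (zero_lt_one' Ordinal.{u})) a ha)
  rw [toSet_preProj_succ] at this
  rw [← this] at hne
  obtain ⟨_, y, hy, -⟩ := hne
  obtain ⟨b, hb, hb', -⟩ := (finalChainTrans_limit hl).1 hy
  exact hno b hb hb'

/-! ## Existence of branches -/

/-- The component at `k + 1` of an element of a limit level. -/
noncomputable def sect {l : Ordinal.{u}} (hl : IsSuccPrelimit l) (a : PreLevel l) (k : Ordinal.{u})
    (hk : k < l) : Set (PreLevel k) :=
  PreLevel.toSet k (preConn l (succ k) (hl.succ_lt hk).le a)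

theorem image_preConn_sect {κ : WithTop Cardinal.{u}} {l : Ordinal.{u}} (hl : IsSuccPrelimit l)
    {a : PreLevel l} (ha : a ∈ level κ l) {j k : Ordinal.{u}} (hjk : j ≤ k) (hk : k < l) :
    preConn k j hjk '' sect hl a k hk = sect hl a j (hjk.trans_lt hk) := by
  rw [sect, ← toSet_preConn (succ_le_succ hjk), preConn_comp κ _ _ _ _ _ _ ha]
  rfl

theorem preConn_mem_sect {κ : WithTop Cardinal.{u}} {l : Ordinal.{u}} (hl : IsSuccPrelimit l)
    {a : PreLevel l} (ha : a ∈ level κ l) {j k : Ordinal.{u}} (hjk : j ≤ k) (hk : k < l)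
    {x : PreLevel k} (hx : x ∈ sect hl a k hk) :
    preConn k j hjk x ∈ sect hl a j (hjk.trans_lt hk) := by
  rw [← image_preConn_sect hl ha hjk hk]
  exact ⟨x, hx, rfl⟩

theorem exists_preConn_eq_of_mem_sect {κ : WithTop Cardinal.{u}} {l : Ordinal.{u}}
    (hl : IsSuccPrelimit l) {a : PreLevel l} (ha : a ∈ level κ l) {j k : Ordinal.{u}} (hjk : j ≤ k)
    (hk : k < l) {x : PreLevel j} (hx : x ∈ sect hl a j (hjk.trans_lt hk)) :
    ∃ y ∈ sect hl a k hk, preConn k j hjk y = x := by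
  rwa [← image_preConn_sect hl ha hjk hk] at hx

theorem sect_subset_level {κ : WithTop Cardinal.{u}} {l : Ordinal.{u}} (hl : IsSuccPrelimit l)
    {a : PreLevel l} (ha : a ∈ level κ l) (k : Ordinal.{u}) (hk : k < l) :
    sect hl a k hk ⊆ level κ k :=
  (mem_level_succ.1 (preConn_mem κ l _ (hl.succ_lt hk).le a ha)).1

theorem sizeLT_sect {κ : WithTop Cardinal.{u}} {l : Ordinal.{u}} (hl : IsSuccPrelimit l)
    {a : PreLevel l} (ha : a ∈ level κ l) (k : Ordinal.{u}) (hk : k < l) :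
    SizeLT κ (sect hl a k hk) :=
  (mem_level_succ.1 (preConn_mem κ l _ (hl.succ_lt hk).le a ha)).2

/-- A compatible family, indexed by a cofinal family of levels, yields a branch. -/
theorem exists_branch_of_cofinal {κ : WithTop Cardinal.{u}} {l : Ordinal.{u}}
    (hl : IsSuccPrelimit l) {a : PreLevel l} (ha : a ∈ level κ l) {ι : Type w} [LinearOrder ι]
    {g : ι → Ordinal.{u}} (hg : Monotone g) (hgl : ∀ n, g n < l) (hcof : ∀ k < l, ∃ n, k ≤ g n)
    (z : ∀ n, PreLevel (g n)) (hz : ∀ n, z n ∈ sect hl a (g n) (hgl n))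
    (hcomp : ∀ (n m : ι) (h : n ≤ m), preConn (g m) (g n) (hg h) (z m) = z n)
    (n₀ : ι) (j : Ordinal.{u}) (hj : j ≤ g n₀) :
    ∃ b ∈ level κ l, preConn l j (hj.trans (hgl n₀).le) b = preConn (g n₀) j hj (z n₀) ∧
      ∀ (k : Ordinal.{u}) (hk : k < l), preConn l k hk.le b ∈ sect hl a k hk := by
  have hzl : ∀ n, z n ∈ level κ (g n) := fun n => sect_subset_level hl ha _ _ (hz n)
  have key : ∀ (k : Ordinal.{u}) (n m : ι) (hn : k ≤ g n) (hm : k ≤ g m),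
      preConn (g n) k hn (z n) = preConn (g m) k hm (z m) := by
    intro k n m hn hm
    wlog h : n ≤ m generalizing n m
    · exact (this m n hm hn (le_of_not_ge h)).symm
    · rw [← hcomp n m h, preConn_comp κ _ _ _ _ _ _ (hzl m)]
  choose N hN using hcof
  let b : PreLevel l := (PreLevel.component hl).symm
    fun k hk => preConn (g (N k hk)) k (hN k hk) (z (N k hk))
  have hb : ∀ (k : Ordinal.{u}) (hk : k < l),
      preConn l k hk.le b = preConn (g (N k hk)) k (hN k hk) (z (N k hk)) := fun k hk => by
    rw [preConn_limit_lt hl hk, Equiv.apply_symm_apply]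
  refine ⟨b, (mem_level_limit hl).2 ?_, ?_, fun k hk => ?_⟩
  · simp only [b, Equiv.apply_symm_apply]
    refine ⟨fun k hk => preConn_mem κ _ _ _ _ (hzl _), fun k m hkm hm => ?_⟩
    rw [preConn_comp κ _ _ _ _ _ _ (hzl _)]
    exact key _ _ _ _ _
  · rw [hb j (hj.trans_lt (hgl n₀))]
    exact key _ _ _ _ _
  · rw [hb]
    exact preConn_mem_sect hl ha (hN k hk) (hgl _) (hz _)

theorem hasBranches_zero (κ : WithTop Cardinal.{u}) (a : PreLevel (0 : Ordinal.{u})) :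
    HasBranches κ isSuccPrelimit_zero a := fun _ hj => absurd hj not_lt_zero

theorem hasBranches_of_isOmegaCofinal {κ : WithTop Cardinal.{u}} {l : Ordinal.{u}}
    (hl : IsSuccPrelimit l) (hω : IsOmegaCofinal l) {a : PreLevel l} (ha : a ∈ level κ l) :
    HasBranches κ hl a := by
  obtain ⟨f, hf, hlub⟩ := hω
  have hfl : ∀ n, f n < l := fun n => (hf (Nat.lt_succ_self n)).trans_le (hlub.1 ⟨_, rfl⟩)
  intro j hj x hx
  -- Cutting off at `j` lets the recursion start above the given element `x`; the sequence may then
  -- be constant at first, so only monotonicity is kept.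
  let g : ℕ → Ordinal.{u} := fun n => max (f n) j
  have hg : Monotone g := fun n m h => max_le_max (hf.monotone h) le_rfl
  have hgl : ∀ n, g n < l := fun n => max_lt (hfl n) hj
  have hcof : ∀ k < l, ∃ n, k ≤ g n := fun k hk => by
    obtain ⟨_, ⟨n, rfl⟩, hn, -⟩ := hlub.exists_between hk
    exact ⟨n, hn.le.trans (le_max_left _ _)⟩
  have hstart := exists_preConn_eq_of_mem_sect hl ha (le_max_right (f 0) j) (hgl 0) hx
  have hstep : ∀ (n : ℕ) (y : sect hl a (g n) (hgl n)), ∃ z : sect hl a (g (n + 1)) (hgl (n + 1)),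
      preConn _ _ (hg n.le_succ) z.1 = y.1 := fun n y => by
    obtain ⟨z, hz, hzy⟩ := exists_preConn_eq_of_mem_sect hl ha (hg n.le_succ) (hgl (n + 1)) y.2
    exact ⟨⟨z, hz⟩, hzy⟩
  obtain ⟨z₀, hz₀, hz₀x⟩ := hstart
  choose next hnext using hstep
  let z : ∀ n, sect hl a (g n) (hgl n) := fun n => Nat.rec ⟨z₀, hz₀⟩ (fun n y => next n y) n
  have hz : ∀ (n m : ℕ) (h : n ≤ m), preConn (g m) (g n) (hg h) (z m).1 = (z n).1 := by
    intro n m h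
    induction m, h using Nat.le_induction with
    | base => exact preConn_self _ _
    | succ m h ih =>
      rw [← ih, ← hnext m (z m), preConn_comp κ _ _ _ _ _ _ (sect_subset_level hl ha _ _ (z _).2)]
  obtain ⟨b, hb, hbj, hbk⟩ := exists_branch_of_cofinal hl ha hg hgl hcof (fun n => (z n).1)
    (fun n => (z n).2) hz 0 j (le_max_right _ _)
  exact ⟨b, hb, hbj.trans hz₀x, hbk⟩

theorem mk_lt_lift_iff {c : Cardinal.{u}} {A : Type (u + 1)} :
    #A < Cardinal.lift.{u + 1, u} c ↔ ∃ X : Type u, #X < c ∧ Nonempty (A ≃ X) := by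
  constructor
  · intro h
    obtain ⟨d, hd, e⟩ := (Cardinal.lt_lift_iff.{u, u + 1} (a := c) (b := #A)).1 h
    refine ⟨d.out, by rwa [mk_out], ?_⟩
    rw [← Cardinal.lift_mk_eq', mk_out, ← e, Cardinal.lift_id'.{u, u + 1}]
  · rintro ⟨X, hX, h⟩
    have := Cardinal.lift_mk_eq'.2 h
    rw [Cardinal.lift_id'.{u, u + 1}] at this
    rwa [this, Cardinal.lift_lt]

/-- The tree property speaks of trees in universe `u`, the levels of the final chain live in `u +
1`. Levels of size below `c` have copies in `u`. -/
theorem HasTreeProperty.exists_isFullBranch {c : Cardinal.{u}} (hc : HasTreeProperty c)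
    (D : InverseChain.{u + 1} (Set.Iio c.ord)) (hD : D.IsTidy)
    (hs : ∀ i, #(D.obj i) < Cardinal.lift.{u + 1} c) : ∃ x, D.IsFullBranch x := by
  choose X hX e using fun i => mk_lt_lift_iff.1 (hs i)
  let e := fun i => (e i).some
  let D' : InverseChain.{u} (Set.Iio c.ord) :=
    { obj := X
      map := fun {j i} h x => e j (D.map h ((e i).symm x))
      map_id := fun i x => by simp [D.map_id]
      map_comp := fun hkj hji x => by simp [D.map_comp] }
  have hD' : D'.IsTidy := by
    refine ⟨fun j i h => ?_, fun i hi x y hxy => ?_, ?_⟩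
    · exact (e j).surjective.comp ((hD.surjective j i h).comp (e i).symm.surjective)
    · exact (e i).symm.injective (hD.limit_unique i hi _ _ fun j h => (e j).injective (hxy j h))
    · obtain ⟨i, hi, ⟨x⟩⟩ := hD.root
      exact ⟨i, hi, ⟨e i x⟩⟩
  obtain ⟨x, hx⟩ := hc D' hD' hX
  exact ⟨fun i => (e i).symm (x i), fun j i h => (e j).injective <|
    (hx j i h).trans ((e j).apply_symm_apply _).symm⟩

/-- The tree property is applied to the subtree of elements comparable with `x`, so that the branch
it yields passes through `x`. -/
theorem hasBranches_of_hasTreeProperty {κ : WithTop Cardinal.{u}} {c : Cardinal.{u}}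
    (hl : IsSuccPrelimit c.ord) (hc : HasTreeProperty c)
    {a : PreLevel c.ord} (ha : a ∈ level κ c.ord)
    (hs : ∀ (k : Ordinal.{u}) (hk : k < c.ord), #(sect hl a k hk) < Cardinal.lift.{u + 1} c) :
    HasBranches κ hl a := by
  intro j hj x hx
  have hmax : ∀ i : Set.Iio c.ord, max i.1 j < c.ord := fun i => max_lt i.2 hj
  -- A common preimage at level `max i j` expresses comparability uniformly: below `j` it leaves
  -- only the image of `x`, above `j` the elements over `x`.
  let O : Set.Iio c.ord → Type (u + 1) := fun i => {y : PreLevel i.1 //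
    ∃ z ∈ sect hl a (max i.1 j) (hmax i), preConn _ i.1 (le_max_left _ _) z = y ∧
      preConn _ j (le_max_right _ _) z = x}
  have hO : ∀ {i} (y : O i), y.1 ∈ sect hl a i.1 i.2 := by
    rintro i ⟨_, z, hz, rfl, -⟩
    exact preConn_mem_sect hl ha _ _ hz
  have hOl : ∀ {i} (y : O i), y.1 ∈ level κ i.1 := fun y => sect_subset_level hl ha _ _ (hO y)
  have hm : ∀ {k i : Set.Iio c.ord} (h : k ≤ i) (y : O i),
      ∃ z ∈ sect hl a (max k.1 j) (hmax k), preConn _ k.1 (le_max_left _ _) z = preConn i.1 k.1 h y.1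
      ∧ preConn _ j (le_max_right _ _) z = x := by
    rintro k i h ⟨_, z, hz, rfl, hzx⟩
    have hz' := sect_subset_level hl ha _ _ hz
    refine ⟨preConn _ _ (max_le_max h le_rfl) z, preConn_mem_sect hl ha _ _ hz, ?_, ?_⟩
    · rw [preConn_comp κ _ _ _ _ _ _ hz', preConn_comp κ _ _ _ _ _ _ hz']
    · rwa [preConn_comp κ _ _ _ _ _ _ hz']
  let D : InverseChain.{u + 1} (Set.Iio c.ord) :=
    { obj := O
      map := fun {k i} h y => ⟨preConn i.1 k.1 h y.1, hm h y⟩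
      map_id := fun i y => Subtype.ext (preConn_self _ _)
      map_comp := fun hkj hji y => Subtype.ext (preConn_comp κ _ _ _ _ _ _ (hOl y)) }
  have hD : D.IsTidy := by
    refine ⟨?_, ?_, ?_⟩
    · rintro k i h ⟨_, z, hz, rfl, hzx⟩
      obtain ⟨z', hz', rfl⟩ := exists_preConn_eq_of_mem_sect hl ha
        (max_le_max (show k.1 ≤ i.1 from h) (le_refl j)) (hmax i) hz
      have hz'' := sect_subset_level hl ha _ _ hz'
      rw [preConn_comp κ _ _ _ _ _ _ hz''] at hzx
      refine ⟨⟨preConn _ _ (le_max_left _ _) z', z', hz', rfl, hzx⟩, Subtype.ext ?_⟩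
      show preConn _ _ _ (preConn _ _ _ z') = preConn _ _ _ (preConn _ _ _ z')
      rw [preConn_comp κ _ _ _ _ _ _ hz'', preConn_comp κ _ _ _ _ _ _ hz'']
    · intro i hi y y' h
      have hi' : IsSuccPrelimit i.1 := by
        intro k hk
        refine hi ⟨k, hk.lt.trans i.2⟩ ⟨hk.lt, ?_⟩
        intro m h1 h2
        exact hk.2 (c := m.1) h1 h2
      refine Subtype.ext (PreLevel.ext_of_isSuccPrelimit hi' fun k hk => ?_)
      exact congrArg Subtype.val (h ⟨k, hk.trans i.2⟩ hk)
    · have h0 : (0 : Ordinal.{u}) < c.ord := lt_of_le_of_lt zero_le hj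
      obtain ⟨z, hz, hzx⟩ := exists_preConn_eq_of_mem_sect hl ha (le_max_right 0 j)
        (max_lt h0 hj) hx
      exact ⟨⟨0, h0⟩, fun _ => zero_le (α := Ordinal.{u}),
        ⟨⟨preConn _ _ (le_max_left _ _) z, z, hz, rfl, hzx⟩⟩⟩
  have hDs : ∀ i, #(D.obj i) < Cardinal.lift.{u + 1} c := fun i =>
    (mk_le_of_injective (f := fun y : O i => (⟨y.1, hO y⟩ : sect hl a i.1 i.2))
      fun y y' h => Subtype.ext (congrArg (fun t => t.1) h)).trans_lt (hs i.1 i.2)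
  obtain ⟨y, hy⟩ := hc.exists_isFullBranch D hD hDs
  obtain ⟨b, hb, hbj, hbk⟩ := exists_branch_of_cofinal hl ha (ι := Set.Iio c.ord)
    (g := fun i => i.1) (fun _ _ h => h) (fun i => i.2) (fun k hk => ⟨⟨k, hk⟩, le_rfl⟩)
    (fun i => (y i).1) (fun i => hO (y i)) (fun k i h => congrArg Subtype.val (hy k i h))
    ⟨j, hj⟩ j le_rfl
  refine ⟨b, hb, ?_, hbk⟩
  rw [hbj, preConn_self]
  obtain ⟨z, -, hz, hzx⟩ := (y ⟨j, hj⟩).2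
  exact hz.symm.trans hzx

/-- Successor levels are power sets. At a limit, a family is determined by its graph, a subset of a
disjoint union that has size below `c` by regularity. -/
theorem IsStronglyInaccessible.mk_preLevel_lt {c : Cardinal.{u}} (hc : IsStronglyInaccessible c)
    (k : Ordinal.{u}) (hk : k < c.ord) : #(PreLevel k) < Cardinal.lift.{u + 1} c := by
  have hset : ∀ {A : Type (u + 1)}, #A < Cardinal.lift.{u + 1} c →
      #(Set A) < Cardinal.lift.{u + 1} c := fun h => by
    obtain ⟨X, hX, ⟨e⟩⟩ := mk_lt_lift_iff.1 h
    exact mk_lt_lift_iff.2 ⟨Set X, hc.2 X hX, ⟨Equiv.Set.congr e⟩⟩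
  induction k using SuccOrder.prelimitRecOn with
  | succ k _ ih =>
    rw [mk_congr (PreLevel.toSet k)]
    exact hset (ih ((lt_succ k).trans hk))
  | isSuccPrelimit k hk' ih =>
    have : ∀ j : k.ToType, (j.toOrd : Ordinal.{u}) < k := fun j => j.toOrd.2
    choose X hX e using fun j : k.ToType => mk_lt_lift_iff.1 (ih j.toOrd (this j)
      ((this j).trans hk))
    have hS : #(Σ j, X j) < c := by
      rw [mk_sigma]
      exact sum_lt_of_isRegular hc.1 (by rw [mk_toType]; exact lt_ord.1 hk) hX
    refine (mk_le_of_injective (β := ULift.{u + 1} (Set (Σ j, X j)))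
      (f := fun a => ⟨Set.range fun j => ⟨j, (e j).some
        (PreLevel.component hk' a j.toOrd (this j))⟩⟩) ?_).trans_lt ?_
    · intro a b hab
      apply (PreLevel.component hk').injective
      funext j hj
      have h1 := congrArg ULift.down hab
      have h2 := h1.subset ⟨Ordinal.ToType.mk ⟨j, hj⟩, rfl⟩
      obtain ⟨m, hm⟩ := h2
      obtain rfl : m = Ordinal.ToType.mk ⟨j, hj⟩ := congrArg Sigma.fst hm
      have h3 := (e _).some.injective (eq_of_heq (Sigma.mk.inj hm).2)
      have h4 : ((Ordinal.ToType.mk ⟨j, hj⟩ : k.ToType).toOrd : Ordinal.{u}) = j := by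
        simp
      have h5 : ∀ (m : Ordinal.{u}) (hm : m < k), m = j → PreLevel.component hk' b m hm =
          PreLevel.component hk' a m hm → PreLevel.component hk' a j hj =
          PreLevel.component hk' b j hj := by
        rintro m hm rfl h
        exact h.symm
      exact h5 _ _ h4 h3
    · rw [mk_uLift, Cardinal.lift_lt]
      exact hc.2 _ hS

/-! ## Injectivity of the connecting maps beyond `κ` -/

/-- If `x ∈ a` is not in `b`, then by induction it differs from each of the fewer than `c` elements
of `b` at some level below `c`. Regularity bounds these levels by one `s < c`, so `a` and `b`
already differ at level `s + 1`. -/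
theorem preConn_injOn_of_ord_le {c : Cardinal.{u}} (hc : c.IsRegular) (k : Ordinal.{u})
    (hk : c.ord ≤ k) : Set.InjOn (preConn k c.ord hk) (level c k) := by
  have hcl : IsSuccLimit c.ord := isSuccLimit_ord hc.aleph0_le
  induction k using SuccOrder.prelimitRecOn with
  | succ k _ ih =>
    have hck : c.ord ≤ k := by
      by_contra! h
      exact (hcl.succ_lt h).not_ge hk
    have main : ∀ a ∈ level c (succ k), ∀ b ∈ level c (succ k),
        preConn (succ k) c.ord hk a = preConn (succ k) c.ord hk b →
        PreLevel.toSet k a ⊆ PreLevel.toSet k b := by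
      intro a ha b hb hab x hx
      by_contra hxb
      have hxk := (mem_level_succ.1 ha).1 hx
      have hsep : ∀ y : PreLevel.toSet k b, ∃ m : Ordinal.{u}, ∃ hm : m < c.ord,
          preConn k m (hm.le.trans hck) x ≠ preConn k m (hm.le.trans hck) y.1 := by
        intro y
        by_contra! h
        have hyk := (mem_level_succ.1 hb).1 y.2
        refine hxb ((ih hck hxk hyk ?_) ▸ y.2)
        refine PreLevel.ext_of_isSuccPrelimit hcl.isSuccPrelimit fun m hm => ?_
        rw [preConn_comp _ _ _ _ _ _ _ hxk, preConn_comp _ _ _ _ _ _ _ hyk]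
        exact h m hm
      choose m hm hne using hsep
      obtain ⟨Y, hY, ⟨e⟩⟩ := mk_lt_lift_iff.1 ((mem_level_succ.1 hb).2 c rfl)
      have hs : (⨆ y : Y, m (e.symm y)) < c.ord :=
        Ordinal.iSup_lt_of_lt_cof (by rwa [hc.cof_ord]) fun y => hm _
      set s := ⨆ y : Y, m (e.symm y) with hs'
      have hms : ∀ y, m y ≤ s := fun y => by
        have := Ordinal.le_iSup (fun y : Y => m (e.symm y)) (e y)
        simpa using this
      have hsc := (hcl.succ_lt hs).le
      have h1 := congrArg (PreLevel.toSet s) (congrArg (preConn c.ord (succ s) hsc) hab)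
      rw [preConn_comp _ _ _ _ _ _ _ ha, preConn_comp _ _ _ _ _ _ _ hb, toSet_preConn,
        toSet_preConn] at h1
      obtain ⟨y, hy, hyx⟩ := h1.subset ⟨x, hx, rfl⟩
      have h2 := congrArg (preConn s (m ⟨y, hy⟩) (hms _)) hyx
      rw [preConn_comp _ _ _ _ _ _ _ ((mem_level_succ.1 hb).1 hy),
        preConn_comp _ _ _ _ _ _ _ hxk] at h2
      exact hne ⟨y, hy⟩ h2.symm
    intro a ha b hb hab
    exact (PreLevel.toSet k).injective
      ((main a ha b hb hab).antisymm (main b hb a ha hab.symm))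
  | isSuccPrelimit k hk' ih =>
    intro a ha b hb hab
    refine PreLevel.ext_of_isSuccPrelimit hk' fun m hm => ?_
    rcases hk.eq_or_lt with rfl | hlt
    · rw [preConn_self, preConn_self] at hab
      rw [hab]
    · have hM : max m c.ord < k := max_lt hm hlt
      have := ih _ hM (le_max_right _ _) (preConn_mem _ _ _ hM.le a ha)
        (preConn_mem _ _ _ hM.le b hb) (by
          rw [preConn_comp _ _ _ _ _ _ _ ha, preConn_comp _ _ _ _ _ _ _ hb, hab])
      have := congrArg (preConn _ m (le_max_left _ _)) this
      rwa [preConn_comp _ _ _ _ _ _ _ ha, preConn_comp _ _ _ _ _ _ _ hb] at this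

/-- Preimages of one element at a level `M ≥ c` are chosen at all levels from `M` on. They are
automatically compatible, since their images at level `c` coincide and the maps to that level are
injective. -/
theorem hasBranches_of_ord_lt {c : Cardinal.{u}} (hc : c.IsRegular) {l : Ordinal.{u}}
    (hl : IsSuccPrelimit l) (hcl : c.ord < l) {a : PreLevel l} (ha : a ∈ level c l) :
    HasBranches c hl a := by
  intro j hj x hx
  set M := max j c.ord with hM
  have hMl : M < l := max_lt hj hcl
  obtain ⟨x', hx', hx'x⟩ := exists_preConn_eq_of_mem_sect hl ha (le_max_left j c.ord) hMl hx
  choose z hz hzx using fun i : Set.Ico M l =>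
    exists_preConn_eq_of_mem_sect hl ha i.2.1 i.2.2 hx'
  have hzl : ∀ i, z i ∈ level c i.1 := fun i => sect_subset_level hl ha _ _ (hz i)
  obtain ⟨b, hb, hbj, hbk⟩ := exists_branch_of_cofinal hl ha (ι := Set.Ico M l)
    (g := fun i => i.1) (fun _ _ h => h) (fun i => i.2.2)
    (fun k hk => ⟨⟨max k M, le_max_right _ _, max_lt hk hMl⟩, le_max_left _ _⟩) z hz
    (fun k i h => by
      refine preConn_injOn_of_ord_le hc k.1 ((le_max_right _ _).trans k.2.1)
        (preConn_mem _ _ _ _ _ (hzl i)) (hzl k) ?_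
      have e1 := (hzx i).trans (hzx k).symm
      have e2 := congrArg (preConn M c.ord (le_max_right _ _)) e1
      rw [preConn_comp _ _ _ _ _ _ _ (hzl i), preConn_comp _ _ _ _ _ _ _ (hzl k)] at e2
      rw [preConn_comp _ _ _ _ _ _ _ (hzl i), e2]) ⟨M, le_rfl, hMl⟩ j (le_max_left _ _)
  refine ⟨b, hb, ?_, hbk⟩
  rw [hbj, ← hx'x, ← hzx ⟨M, le_rfl, hMl⟩, preConn_comp _ _ _ _ _ _ _ (hzl _)]

theorem IsExtensible.hasBranches {κ : WithTop Cardinal.{u}} (hκ : IsInfiniteRegular κ)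
    {l : Ordinal.{u}} (hl : IsSuccPrelimit l) (h : IsExtensible κ l) {a : PreLevel l}
    (ha : a ∈ level κ l) : HasBranches κ hl a := by
  rcases h.2 with rfl | h | ⟨c, hc, rfl⟩ | ⟨c, rfl, hcl⟩ | ⟨c, rfl, hc, rfl⟩
  · exact hasBranches_zero κ a
  · exact hasBranches_of_isOmegaCofinal hl h ha
  · exact hasBranches_of_hasTreeProperty hl hc.2 ha fun k hk =>
      (mk_set_le _).trans_lt (hc.1.mk_preLevel_lt k hk)
  · exact hasBranches_of_ord_lt (hκ c rfl) hl
      ((lt_add_of_pos_right _ omega0_pos).trans_le hcl) ha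
  · exact hasBranches_of_hasTreeProperty hl hc ha fun k hk => sizeLT_sect hl ha k hk c rfl

/-! ## Sets as states -/

/-- The `j`-th coalgebra projection of a set, as a state of the transition system of all sets, the
successors of a set being its elements. -/
noncomputable def setProj (j : Ordinal.{u}) (x : ZFSet.{u}) : PreLevel j :=
  preProj (fun x y : ZFSet.{u} => y ∈ x) j x

/-- Sets with the same `j`-th projection. -/
def EqvAt (j : Ordinal.{u}) (x y : ZFSet.{u}) : Prop :=
  setProj j x = setProj j y

theorem EqvAt.refl (j : Ordinal.{u}) (x : ZFSet.{u}) : EqvAt j x x := Eq.refl _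

theorem EqvAt.symm {j : Ordinal.{u}} {x y : ZFSet.{u}} (h : EqvAt j x y) : EqvAt j y x :=
  Eq.symm h

theorem EqvAt.trans {j : Ordinal.{u}} {x y z : ZFSet.{u}} (h : EqvAt j x y) (h' : EqvAt j y z) :
    EqvAt j x z :=
  Eq.trans h h'

theorem EqvAt.mono {j k : Ordinal.{u}} {x y : ZFSet.{u}} (h : EqvAt j x y) (hk : k ≤ j) :
    EqvAt k x y := by
  unfold EqvAt setProj at *
  rw [← preConn_preProj _ j k hk, ← preConn_preProj _ j k hk, h]

theorem toSet_setProj_succ (j : Ordinal.{u}) (x : ZFSet.{u}) :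
    PreLevel.toSet j (setProj (succ j) x) = setProj j '' {y | y ∈ x} :=
  toSet_preProj_succ _ j x

theorem eqvAt_succ {j : Ordinal.{u}} {x y : ZFSet.{u}} :
    EqvAt (succ j) x y ↔
      (∀ x' ∈ x, ∃ y' ∈ y, EqvAt j x' y') ∧ ∀ y' ∈ y, ∃ x' ∈ x, EqvAt j x' y' := by
  rw [EqvAt, ← (PreLevel.toSet j).injective.eq_iff, toSet_setProj_succ, toSet_setProj_succ,
    Set.Subset.antisymm_iff]
  refine and_congr ⟨fun h x' hx' => ?_, fun h => ?_⟩ ⟨fun h y' hy' => ?_, fun h => ?_⟩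
  · obtain ⟨y', hy', e⟩ := h ⟨x', hx', rfl⟩
    exact ⟨y', hy', e.symm⟩
  · rintro _ ⟨x', hx', rfl⟩
    obtain ⟨y', hy', e⟩ := h x' hx'
    exact ⟨y', hy', e.symm⟩
  · obtain ⟨x', hx', e⟩ := h ⟨y', hy', rfl⟩
    exact ⟨x', hx', e⟩
  · rintro _ ⟨y', hy', rfl⟩
    obtain ⟨x', hx', e⟩ := h y' hy'
    exact ⟨x', hx', e⟩

theorem eqvAt_of_isSuccPrelimit {l : Ordinal.{u}} (hl : IsSuccPrelimit l) {x y : ZFSet.{u}}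
    (h : ∀ k < l, EqvAt k x y) : EqvAt l x y := by
  refine PreLevel.ext_of_isSuccPrelimit hl fun k hk => ?_
  have := h k hk
  unfold EqvAt setProj at *
  rwa [preConn_preProj, preConn_preProj]

/-- All projections of the set `x` belong to the final chain of `𝒫_{<κ}`. -/
def ProjectsInto (κ : WithTop Cardinal.{u}) (x : ZFSet.{u}) : Prop :=
  ∀ j : Ordinal.{u}, setProj j x ∈ level κ j

theorem projectsInto_of_mem {κ : WithTop Cardinal.{u}} {x : ZFSet.{u}}
    (hs : SizeLT κ {y | y ∈ x}) (h : ∀ y ∈ x, ProjectsInto κ y) : ProjectsInto κ x :=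
  preProj_mem_level _ hs h

theorem sizeLT_of_forall_exists {κ : WithTop Cardinal.{u}} {X : Type (u + 1)} {ι : Type u}
    (hι : ∀ c : Cardinal.{u}, κ = c → #ι < c) (f : ι → X) {s : Set X}
    (hs : ∀ x ∈ s, ∃ a, f a = x) : SizeLT κ s := by
  intro c hc
  have h1 : #s ≤ #(Set.range f) := mk_le_mk_of_subset hs
  have h2 : Cardinal.lift.{u} #(Set.range f) ≤ Cardinal.lift.{u + 1} #ι := mk_range_le_lift
  rw [Cardinal.lift_id'.{u, u + 1}] at h2
  exact h1.trans_lt (h2.trans_lt (Cardinal.lift_lt.2 (hι c hc)))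

theorem projectsInto_range {κ : WithTop Cardinal.{u}} {ι : Type u}
    (hι : ∀ c : Cardinal.{u}, κ = c → #ι < c) {f : ι → ZFSet.{u}}
    (hf : ∀ a, ProjectsInto κ (f a)) : ProjectsInto κ (ZFSet.range f) := by
  refine projectsInto_of_mem (sizeLT_of_forall_exists hι f fun x hx => ZFSet.mem_range.1 hx) ?_
  intro y hy
  obtain ⟨a, rfl⟩ := ZFSet.mem_range.1 hy
  exact hf a

/-! ## From coded trees to elements without successors -/

/-- The set of the codes `e m (q m)` of the letters of the word `q` up to position `a`. -/
noncomputable def wordSet {E : Type v} (e : Ordinal.{u} → E → ZFSet.{u}) (a : Ordinal.{u})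
    (q : Ordinal.{u} → E) : ZFSet.{u} :=
  ZFSet.range fun m : (succ a).ToType => e m.toOrd (q m.toOrd)

theorem mem_wordSet {E : Type v} {e : Ordinal.{u} → E → ZFSet.{u}} {a : Ordinal.{u}}
    {q : Ordinal.{u} → E} {x : ZFSet.{u}} :
    x ∈ wordSet e a q ↔ ∃ m ≤ a, e m (q m) = x := by
  rw [wordSet, ZFSet.mem_range]
  constructor
  · rintro ⟨m, rfl⟩
    exact ⟨m.toOrd, lt_succ_iff.1 m.toOrd.2, rfl⟩
  · rintro ⟨m, hm, rfl⟩
    refine ⟨ToType.mk ⟨m, lt_succ_iff.2 hm⟩, ?_⟩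
    simp

/-- Codes for letters from `E` at all positions below `i`: the codes of all letters at position at
least `a` look alike at level `h a`, and the code of a letter at a position below `a` is recognized
at level `h a`, up to the reading `rd`. -/
structure LetterCoding (i : Ordinal.{u}) (E : Type v) where
  height : Ordinal.{u} → Ordinal.{u}
  height_mono : Monotone height
  le_height : ∀ a, a ≤ height a
  height_lt : ∀ a < i, height a < i
  code : Ordinal.{u} → E → ZFSet.{u}
  read : Ordinal.{u} → E → E
  eqvAt : ∀ a b : Ordinal.{u}, a ≤ b → b < i → ∀ x y, EqvAt (height a) (code a x) (code b y)
  eq_of_eqvAt : ∀ a b c : Ordinal.{u}, a < c → b < i → c < i → ∀ x y,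
    EqvAt (height c) (code a x) (code b y) → a = b ∧ read a x = read a y

/-- The word set up to `a` includes the letter at `a` itself although the words are assumed to agree
only below `a`: at this height that letter looks like every letter at a position from `a` on and so
matches all of them. -/
theorem LetterCoding.eqvAt_wordSet {i : Ordinal.{u}} {E : Type v} (C : LetterCoding i E)
    {a b : Ordinal.{u}} (hab : a ≤ b) (hb : b < i) {p q : Ordinal.{u} → E}
    (h : ∀ m < a, p m = q m) :
    EqvAt (succ (C.height a)) (wordSet C.code a p) (wordSet C.code b q) := by
  refine eqvAt_succ.2 ⟨fun x hx => ?_, fun x hx => ?_⟩ <;> rw [mem_wordSet] at hx <;>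
    obtain ⟨m, hm, rfl⟩ := hx
  · rcases hm.lt_or_eq with hlt | rfl
    · refine ⟨_, mem_wordSet.2 ⟨m, hm.trans hab, rfl⟩, ?_⟩
      rw [h m hlt]
      exact .refl _ _
    · exact ⟨_, mem_wordSet.2 ⟨m, hab, rfl⟩, C.eqvAt _ _ le_rfl (hab.trans_lt hb) _ _⟩
  · rcases lt_or_ge m a with hlt | hle
    · refine ⟨_, mem_wordSet.2 ⟨m, hlt.le, rfl⟩, ?_⟩
      rw [h m hlt]
      exact .refl _ _
    · exact ⟨_, mem_wordSet.2 ⟨a, le_rfl, rfl⟩, C.eqvAt _ _ hle (hm.trans_lt hb) _ _⟩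

theorem LetterCoding.read_eq_of_eqvAt {i : Ordinal.{u}} (hi : IsSuccPrelimit i) {E : Type v}
    (C : LetterCoding i E) {a b m : Ordinal.{u}} (ha : a < i) (hb : b < i) (hma : m ≤ a)
    {p q : Ordinal.{u} → E}
    (h : EqvAt (succ (C.height (succ m))) (wordSet C.code a p) (wordSet C.code b q)) :
    C.read m (p m) = C.read m (q m) := by
  obtain ⟨x, hx, hpx⟩ := (eqvAt_succ.1 h).1 _ (mem_wordSet.2 ⟨m, hma, rfl⟩)
  obtain ⟨m', hm', rfl⟩ := mem_wordSet.1 hx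
  obtain ⟨rfl, h2⟩ := C.eq_of_eqvAt _ _ _ (lt_succ m) (hm'.trans_lt hb)
    (hi.succ_lt (hma.trans_lt ha)) _ _ hpx
  exact h2

theorem LetterCoding.projectsInto_wordSet {κ : WithTop Cardinal.{u}} {i : Ordinal.{u}} {E : Type v}
    (C : LetterCoding i E) (hi : IsSuccPrelimit i) (hκ : ∀ c : Cardinal.{u}, κ = c → i ≤ c.ord)
    (hC : ∀ m < i, ∀ x, ProjectsInto κ (C.code m x)) {a : Ordinal.{u}} (ha : a < i)
    (q : Ordinal.{u} → E) : ProjectsInto κ (wordSet C.code a q) := by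
  refine projectsInto_range (fun c hc => ?_) fun m => hC _ ?_ _
  · rw [mk_toType]
    exact lt_ord.1 ((hi.succ_lt ha).trans_le (hκ c hc))
  · exact m.toOrd.2.trans (hi.succ_lt ha)

/-- A family of words over the letters `E` that forms a tree with surjective restriction maps, but
without full branch up to the reading of letters. -/
structure BranchlessTree (i : Ordinal.{u}) (E : Type v) (read : Ordinal.{u} → E → E) where
  node : Set.Iio i → Type u
  word : ∀ a, node a → Ordinal.{u} → E
  nonempty : ∀ a, Nonempty (node a)
  restrict : ∀ a b, a ≤ b → ∀ t : node b, ∃ s : node a, ∀ m < a.1, word a s m = word b t m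
  extend : ∀ a b, a ≤ b → ∀ s : node a, ∃ t : node b, ∀ m < a.1, word a s m = word b t m
  no_branch : ¬ ∃ q : Ordinal.{u} → E, ∀ a, ∃ t : node a, ∀ m < a.1,
    read m (q m) = read m (word a t m)

/-- The set `G a` of the coded words of all nodes at `a` looks like `G b` at level `a + 1` for all
`b ≥ a`, by restriction and extension of words. The projections of these sets therefore fit together
to an element, and a successor of it would select coherent words, hence a branch up to reading. -/
theorem BranchlessTree.exists_no_successor {κ : WithTop Cardinal.{u}} {i : Ordinal.{u}}
    (hi : IsSuccPrelimit i) (h0 : 0 < i) (hκ : ∀ c : Cardinal.{u}, κ = c → i ≤ c.ord)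
    {E : Type v} (C : LetterCoding i E) (hC : ∀ m < i, ∀ x, ProjectsInto κ (C.code m x))
    (D : BranchlessTree i E C.read) (hD : ∀ (c : Cardinal.{u}) a, κ = c → #(D.node a) < c) :
    ∃ a ∈ level κ i, (sect hi a 0 h0).Nonempty ∧
      ∀ b ∈ level ⊤ i, ¬ ∀ (k : Ordinal.{u}) (hk : k < i), preConn i k hk.le b ∈ sect hi a k hk := by
  let G : Set.Iio i → ZFSet.{u} := fun a => ZFSet.range fun t => wordSet C.code a.1 (D.word a t)
  have hG : ∀ a b : Set.Iio i, a ≤ b → EqvAt (succ a.1) (G a) (G b) := by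
    intro a b hab
    refine eqvAt_succ.2 ⟨fun x hx => ?_, fun x hx => ?_⟩ <;> obtain ⟨t, rfl⟩ := ZFSet.mem_range.1 hx
    · obtain ⟨s, hs⟩ := D.extend a b hab t
      exact ⟨_, ZFSet.mem_range.2 ⟨s, rfl⟩,
        (C.eqvAt_wordSet hab b.2 hs).mono ((C.le_height _).trans (le_succ _))⟩
    · obtain ⟨s, hs⟩ := D.restrict a b hab t
      exact ⟨_, ZFSet.mem_range.2 ⟨s, rfl⟩,
        (C.eqvAt_wordSet hab b.2 hs).mono ((C.le_height _).trans (le_succ _))⟩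
  have hGκ : ∀ a, ProjectsInto κ (G a) := fun a =>
    projectsInto_range (fun c hc => hD c a hc) fun t => C.projectsInto_wordSet hi hκ hC a.2 _
  let a : PreLevel i := (PreLevel.component hi).symm fun k hk => setProj k (G ⟨k, hk⟩)
  have hak : ∀ (k : Ordinal.{u}) (hk : k < i), preConn i k hk.le a = setProj k (G ⟨k, hk⟩) :=
    fun k hk => by rw [preConn_limit_lt hi hk, Equiv.apply_symm_apply]
  -- The sets `G k` and `G (k + 1)` agree at level `k + 1`, one more than compatibility requires, so
  -- the component at `k + 1` can be computed from `G k`.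
  have hsect : ∀ (k : Ordinal.{u}) (hk : k < i),
      sect hi a k hk = Set.range fun t => setProj k (wordSet C.code k (D.word ⟨k, hk⟩ t)) := by
    intro k hk
    have h1 : setProj (succ k) (G ⟨k, hk⟩) = setProj (succ k) (G ⟨succ k, hi.succ_lt hk⟩) :=
      hG ⟨k, hk⟩ ⟨succ k, hi.succ_lt hk⟩ (le_succ k)
    rw [sect, hak _ (hi.succ_lt hk), ← h1, toSet_setProj_succ]
    ext x
    simp only [G, ZFSet.mem_range]
    constructor
    · rintro ⟨_, ⟨t, rfl⟩, rfl⟩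
      exact ⟨t, rfl⟩
    · rintro ⟨t, rfl⟩
      exact ⟨_, ⟨t, rfl⟩, rfl⟩
  refine ⟨a, (mem_level_limit hi).2 ?_, ?_, fun b hb H => D.no_branch ?_⟩
  · simp only [a, Equiv.apply_symm_apply]
    refine ⟨fun k hk => hGκ _ _, fun k m hkm hm => ?_⟩
    have := (hG ⟨k, hkm.trans_lt hm⟩ ⟨m, hm⟩ hkm).mono (le_succ k)
    exact (preConn_preProj _ m k hkm _).trans this.symm
  · rw [hsect]
    obtain ⟨t⟩ := D.nonempty ⟨0, h0⟩
    exact ⟨_, t, rfl⟩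
  · have H' : ∀ (k : Ordinal.{u}) (hk : k < i), ∃ t : D.node ⟨k, hk⟩,
        setProj k (wordSet C.code k (D.word ⟨k, hk⟩ t)) = preConn i k hk.le b := by
      intro k hk
      have := H k hk
      rwa [hsect] at this
    choose t ht using H'
    have hcomp : ∀ (k m : Ordinal.{u}) (hkm : k ≤ m) (hm : m < i),
        EqvAt k (wordSet C.code m (D.word ⟨m, hm⟩ (t m hm)))
          (wordSet C.code k (D.word ⟨k, hkm.trans_lt hm⟩ (t k (hkm.trans_lt hm)))) := by
      intro k m hkm hm
      have := congrArg (preConn m k hkm) (ht m hm)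
      rw [preConn_comp ⊤ _ _ _ _ _ _ hb, ← ht k (hkm.trans_lt hm)] at this
      exact (preConn_preProj _ m k hkm _).symm.trans this
    have hJ : ∀ m < i, succ (C.height (succ m)) < i := fun m hm =>
      hi.succ_lt (C.height_lt _ (hi.succ_lt hm))
    classical
    -- The letter at `m` is taken from the word chosen at level `succ (C.height (succ m))`, where
    -- agreement of word sets determines its reading. The value for `m ≥ i` plays no role.
    let q : Ordinal.{u} → E := fun m =>
      if hm : m < i then D.word ⟨_, hJ m hm⟩ (t _ (hJ m hm)) m
      else D.word ⟨0, h0⟩ (t 0 h0) m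
    refine ⟨q, fun α => ?_⟩
    have hα : succ (C.height α.1) < i := hi.succ_lt (C.height_lt _ α.2)
    have hα' : α.1 ≤ succ (C.height α.1) := (C.le_height _).trans (le_succ _)
    obtain ⟨s, hs⟩ := D.restrict α ⟨_, hα⟩ hα' (t _ hα)
    refine ⟨s, fun m hm => ?_⟩
    have hmi : m < i := hm.trans α.2
    simp only [q, dif_pos hmi]
    rw [hs m hm]
    have hle : succ (C.height (succ m)) ≤ succ (C.height α.1) :=
      succ_le_succ (C.height_mono (succ_le_of_lt hm))
    exact (C.read_eq_of_eqvAt hi hα (hJ m hmi) (hm.le.trans hα') (hcomp _ _ hle hα)).symm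

/-! ## Letters that are recognized as late as prescribed -/

/-- Letters whose readings at a position `k > 0` can be told apart by their readings at arbitrarily
late positions below `k`, together with a set of words that is closed under changing all letters
from some position on to a constant. -/
structure LetterSystem (i : Ordinal.{u}) (E : Type v) (W : Type u) where
  read : Ordinal.{u} → E → E
  bit : E → Prop
  word : W → Ordinal.{u} → E
  read_zero : ∀ x y, (bit x ↔ bit y) → read 0 x = read 0 y
  read_eq : ∀ k, k ≠ 0 → ∀ x y, (∃ m < k, ∀ n, m ≤ n → n < k →
    read n (read k x) = read n (read k y)) → read k x = read k y
  glue : ∀ (w : W), ∀ m < i, ∀ x, ∃ w' : W, (∀ n < m, word w' n = word w n) ∧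
    ∀ n, m ≤ n → word w' n = x

namespace LetterSystem

variable {i : Ordinal.{u}} {E : Type v} {W : Type u} (L : LetterSystem i E W)

/-- The word `w` is eventually constant below `k`, the letter being the reading of `x` at `k`. -/
def EndsWith (k : Ordinal.{u}) (x : E) (w : W) : Prop :=
  ∃ m < k, ∀ n, m ≤ n → n < k → L.word w n = L.read k x

open Classical in
/-- The code of the letter `x` at position `k`. -/
noncomputable def code (k : Ordinal.{u}) (x : E) : ZFSet.{u} :=
  if k = 0 then if L.bit x then {∅} else ∅
  else ZFSet.range fun w : {w : W // L.EndsWith k x w} =>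
    ZFSet.range fun n : k.ToType => code n.toOrd (L.word w n.toOrd)
termination_by k
decreasing_by exact n.toOrd.2

/-- The set of the codes of the letters of the word `w` at positions below `k`. -/
noncomputable def segment (k : Ordinal.{u}) (w : W) : ZFSet.{u} :=
  ZFSet.range fun n : k.ToType => L.code n.toOrd (L.word w n.toOrd)

theorem mem_segment {k : Ordinal.{u}} {w : W} {y : ZFSet.{u}} :
    y ∈ L.segment k w ↔ ∃ n < k, L.code n (L.word w n) = y := by
  rw [segment, ZFSet.mem_range]
  constructor
  · rintro ⟨n, rfl⟩
    exact ⟨n.toOrd, n.toOrd.2, rfl⟩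
  · rintro ⟨n, hn, rfl⟩
    exact ⟨ToType.mk ⟨n, hn⟩, by simp⟩

theorem code_eq_range {k : Ordinal.{u}} (hk : k ≠ 0) (x : E) :
    L.code k x = ZFSet.range fun w : {w : W // L.EndsWith k x w} => L.segment k w := by
  rw [code, if_neg hk]
  rfl

theorem mem_code {k : Ordinal.{u}} (hk : k ≠ 0) {x : E} {y : ZFSet.{u}} :
    y ∈ L.code k x ↔ ∃ w, L.EndsWith k x w ∧ L.segment k w = y := by
  rw [code_eq_range L hk, ZFSet.mem_range]
  exact ⟨fun ⟨w, h⟩ => ⟨w.1, w.2, h⟩, fun ⟨w, h, h'⟩ => ⟨⟨w, h⟩, h'⟩⟩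

theorem code_zero (x : E) [Decidable (L.bit x)] :
    L.code 0 x = if L.bit x then {∅} else ∅ := by
  rw [code, if_pos rfl]
  congr

theorem exists_endsWith (w : W) {m k : Ordinal.{u}} (hm : m < k) (hk : k < i) (x : E) :
    ∃ w', L.EndsWith k x w' ∧ ∀ n < m, L.word w' n = L.word w n := by
  obtain ⟨w', h1, h2⟩ := L.glue w m (hm.trans hk) (L.read k x)
  exact ⟨w', ⟨m, hm, fun n hn _ => h2 n hn⟩, h1⟩

/-- Each position costs two levels because a code is a set of segments, which are sets of codes. By
`glue`, a word is free to keep its letters below `a` and still end with any prescribed letter; the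
later letters all look like the one at `a`, by induction. -/
theorem eqvAt_code (a : Ordinal.{u}) : ∀ b : Ordinal.{u}, a ≤ b → b < i → ∀ x y,
    EqvAt (2 * a) (L.code a x) (L.code b y) := by
  induction a using SuccOrder.prelimitRecOn with
  | succ a _ ih =>
    have hseg : ∀ (b : Ordinal.{u}) (w w' : W), succ a ≤ b → b < i →
        (∀ n < a, L.word w' n = L.word w n) →
        EqvAt (succ (2 * a)) (L.segment (succ a) w) (L.segment b w') := by
      intro b w w' hab hb h
      have hai : a < i := (succ_le_iff.1 hab).trans hb
      refine eqvAt_succ.2 ⟨fun z hz => ?_, fun z hz => ?_⟩ <;>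
        obtain ⟨n, hn, rfl⟩ := L.mem_segment.1 hz
      · refine ⟨_, L.mem_segment.2 ⟨n, hn.trans_le hab, rfl⟩, ?_⟩
        rcases (lt_succ_iff.1 hn).lt_or_eq with hlt | rfl
        · rw [h n hlt]
          exact .refl _ _
        · exact ih _ le_rfl hai _ _
      · rcases lt_or_ge n a with hlt | hle
        · refine ⟨_, L.mem_segment.2 ⟨n, hlt.trans (lt_succ a), rfl⟩, ?_⟩
          rw [h n hlt]
          exact .refl _ _
        · exact ⟨_, L.mem_segment.2 ⟨a, lt_succ a, rfl⟩, ih _ hle (hn.trans hb) _ _⟩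
    intro b hab hb x y
    have ha0 : 0 < succ a := zero_le.trans_lt (lt_succ a)
    have hb0 : b ≠ 0 := (ha0.trans_le hab).ne'
    have e : (2 : Ordinal.{u}) * succ a = succ (succ (2 * a)) := by
      simp only [succ_eq_add_one, mul_add, mul_one, add_assoc, one_add_one_eq_two]
    rw [e]
    refine eqvAt_succ.2 ⟨fun z hz => ?_, fun z hz => ?_⟩
    · obtain ⟨w, -, rfl⟩ := (L.mem_code ha0.ne').1 hz
      obtain ⟨w', hw', h⟩ := L.exists_endsWith w (succ_le_iff.1 hab) hb y
      exact ⟨_, (L.mem_code hb0).2 ⟨w', hw', rfl⟩, hseg b w w' hab hb h⟩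
    · obtain ⟨w, -, rfl⟩ := (L.mem_code hb0).1 hz
      obtain ⟨w', hw', h⟩ := L.exists_endsWith w (lt_succ a) (hab.trans_lt hb) x
      exact ⟨_, (L.mem_code ha0.ne').2 ⟨w', hw', rfl⟩,
        hseg b w' w hab hb fun n hn => (h n hn).symm⟩
  | isSuccPrelimit a ha ih =>
    intro b hab hb x y
    have hlim : IsSuccPrelimit (2 * a) := by
      rw [isSuccPrelimit_iff_omega0_dvd] at ha ⊢
      obtain ⟨c, rfl⟩ := ha
      exact ⟨c, by rw [← mul_assoc]; congr 1; exact_mod_cast natCast_mul_omega0 two_pos⟩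
    -- At a limit `a`, both codes are compared with the code of a letter at some position `c < a`
    -- with `k ≤ 2 * c`.
    refine eqvAt_of_isSuccPrelimit hlim fun k hk => ?_
    have hka : k / 2 < a := (lt_mul_iff_div_lt two_ne_zero).1 hk
    obtain ⟨c, hc, hkc⟩ : ∃ c < a, k ≤ 2 * c :=
      ⟨succ (k / 2), ha.succ_lt hka, (lt_mul_succ_div k two_ne_zero).le⟩
    exact (((ih c hc a hc.le (hab.trans_lt hb) x x).symm).trans
      (ih c hc b (hc.le.trans hab) hb x y)).mono hkc

/-- Unwrapping a code and a segment leaves agreement of letters at level `2 * a`, which by induction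
identifies letters at positions below `a`. Equal segments thus have equal readings throughout, and
their constant tails carry the readings of `x` and `y`, which `read_eq` then separates. -/
theorem eq_of_eqvAt_code [Nonempty W] (a : Ordinal.{u}) : ∀ b : Ordinal.{u}, a ≤ b → b < i →
    ∀ x y, EqvAt (2 * succ a) (L.code a x) (L.code b y) → a = b ∧ L.read a x = L.read a y := by
  classical
  induction a using WellFoundedLT.induction with
  | ind a ih =>
  intro b hab hb x y h
  have e : (2 : Ordinal.{u}) * succ a = succ (succ (2 * a)) := by
    simp only [succ_eq_add_one, mul_add, mul_one, add_assoc, one_add_one_eq_two]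
  rw [e] at h
  obtain ⟨h1, h2⟩ := eqvAt_succ.1 h
  have hne : ∀ k y, k ≠ 0 → k < i → ∃ w, L.EndsWith k y w := fun k y hk hki => by
    obtain ⟨w⟩ := ‹Nonempty W›
    obtain ⟨w', hw', -⟩ := L.exists_endsWith w (pos_iff_ne_zero.2 hk) hki y
    exact ⟨w', hw'⟩
  rcases eq_or_ne a 0 with rfl | ha
  · rcases eq_or_ne b 0 with rfl | hb0
    · refine ⟨rfl, L.read_zero x y ?_⟩
      rw [L.code_zero, L.code_zero] at h1 h2
      by_cases hx : L.bit x <;> by_cases hy : L.bit y <;> simp_all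
    · exfalso
      obtain ⟨w, hw⟩ := hne b y hb0 hb
      obtain ⟨z, hz, hzw⟩ := h2 _ ((L.mem_code hb0).2 ⟨w, hw, rfl⟩)
      have hz0 : z = ∅ := by
        rw [L.code_zero] at hz
        split_ifs at hz <;> simp_all
      subst hz0
      obtain ⟨z', hz', -⟩ := (eqvAt_succ.1 hzw).2 _
        (L.mem_segment.2 ⟨0, pos_iff_ne_zero.2 hb0, rfl⟩)
      exact ZFSet.notMem_empty _ hz'
  · have hb0 : b ≠ 0 := ((pos_iff_ne_zero.2 ha).trans_le hab).ne'
    have main : ∀ (n m : Ordinal.{u}) (w w' : W), n < a → m < i →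
        EqvAt (2 * a) (L.code n (L.word w n)) (L.code m (L.word w' m)) →
        n = m ∧ L.read n (L.word w n) = L.read n (L.word w' n) := by
      intro n m w w' hn hm hnm
      rcases le_or_gt n m with hle | hlt
      · have := ih n hn m hle hm _ _ (hnm.mono (mul_le_mul_right (succ_le_of_lt hn) 2))
        obtain ⟨rfl, h⟩ := this
        exact ⟨rfl, h⟩
      · have := ih m (hlt.trans hn) n hlt.le (hn.trans_le (hab.trans hb.le)) _ _
          (hnm.symm.mono (mul_le_mul_right (succ_le_of_lt (hlt.trans hn)) 2))
        exact absurd this.1 hlt.ne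
    obtain ⟨w', hw'⟩ := hne b y hb0 hb
    obtain ⟨z, hz, hzw⟩ := h2 _ ((L.mem_code hb0).2 ⟨w', hw', rfl⟩)
    obtain ⟨w, hw, rfl⟩ := (L.mem_code ha).1 hz
    obtain ⟨h3, h4⟩ := eqvAt_succ.1 hzw
    rcases hab.lt_or_eq with hlt | rfl
    · exfalso
      -- If `a < b`, the segment below `b` has a letter at position `a`, which would have to match
      -- one at a position below `a`.
      obtain ⟨_, hz', hzz⟩ := h4 _ (L.mem_segment.2 ⟨a, hlt, rfl⟩)
      obtain ⟨n, hn, rfl⟩ := L.mem_segment.1 hz'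
      exact hn.ne (main n a w w' hn (hab.trans_lt hb) hzz).1
    · refine ⟨rfl, L.read_eq a ha x y ?_⟩
      obtain ⟨m, hm, hmw⟩ := hw
      obtain ⟨m', hm', hmw'⟩ := hw'
      refine ⟨max m m', max_lt hm hm', fun n hn hna => ?_⟩
      rw [← hmw n ((le_max_left _ _).trans hn) hna, ← hmw' n ((le_max_right _ _).trans hn) hna]
      obtain ⟨_, hz', hzz⟩ := h3 _ (L.mem_segment.2 ⟨n, hna, rfl⟩)
      obtain ⟨n', hn', rfl⟩ := L.mem_segment.1 hz'
      exact (main n n' w w' hna (hn'.trans hb) hzz).2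

theorem two_mul_lt (hi : IsSuccPrelimit i) {a : Ordinal.{u}} (ha : a < i) : 2 * a < i := by
  rw [isSuccPrelimit_iff_omega0_dvd] at hi
  obtain ⟨c, rfl⟩ := hi
  have e : (2 : Ordinal.{u}) * (ω * c) = ω * c := by
    rw [← mul_assoc]; congr 1; exact_mod_cast natCast_mul_omega0 two_pos
  rw [← e]
  exact mul_lt_mul_of_pos_left ha two_pos

/-- The coding of letters by `LetterSystem.code`. -/
noncomputable def letterCoding [Nonempty W] (hi : IsSuccPrelimit i) : LetterCoding i E where
  height a := 2 * a
  height_mono _ _ h := mul_le_mul_right h 2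
  le_height a := le_mul_of_one_le_left' one_le_two
  height_lt _ := two_mul_lt hi
  code := L.code
  read := L.read
  eqvAt a b hab hb x y := L.eqvAt_code a b hab hb x y
  eq_of_eqvAt a b c hac hb hc x y h := by
    rcases le_or_gt a b with hab | hba
    · exact L.eq_of_eqvAt_code a b hab hb x y
        (h.mono (mul_le_mul_right (succ_le_of_lt hac) 2))
    · have := L.eq_of_eqvAt_code b a hba.le (hac.trans hc) y x
        (h.symm.mono (mul_le_mul_right (succ_le_of_lt (hba.trans hac)) 2))
      exact absurd this.1 hba.ne

theorem projectsInto_code {κ : WithTop Cardinal.{u}} (hκ : ∀ c : Cardinal.{u}, κ = c →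
    ℵ₀ ≤ c ∧ i ≤ c.ord ∧ #W < c) (a : Ordinal.{u}) : a < i → ∀ x, ProjectsInto κ (L.code a x) := by
  have h0 : ProjectsInto κ ∅ := by
    refine projectsInto_of_mem (fun c hc => ?_) fun y hy => absurd hy (ZFSet.notMem_empty y)
    have : {y : ZFSet.{u} | y ∈ (∅ : ZFSet.{u})} = ∅ := by ext; simp
    rw [this, mk_eq_zero]
    exact aleph0_pos.trans_le (aleph0_le_lift.2 (hκ c hc).1)
  classical
  induction a using WellFoundedLT.induction with
  | ind a ih =>
  intro hai x
  rcases eq_or_ne a 0 with rfl | ha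
  · rw [L.code_zero]
    split_ifs
    · refine projectsInto_of_mem (fun c hc => ?_) fun y hy => ?_
      · have : {y : ZFSet.{u} | y ∈ ({∅} : ZFSet.{u})} = {∅} := by ext; simp
        rw [this, mk_singleton]
        exact one_lt_aleph0.trans_le (aleph0_le_lift.2 (hκ c hc).1)
      · rw [ZFSet.mem_singleton.1 hy]
        exact h0
    · exact h0
  · rw [L.code_eq_range ha]
    refine projectsInto_range (fun c hc => (mk_subtype_le _).trans_lt (hκ c hc).2.2) fun w => ?_
    refine projectsInto_range (fun c hc => ?_) fun n => ih _ n.toOrd.2 (n.toOrd.2.trans hai) _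
    rw [mk_toType]
    exact lt_ord.1 (hai.trans_le (hκ c hc).2.1)

end LetterSystem

/-! ## Trees without branches at cardinals without the tree property -/

/-- The least function `g` with `g a + b a < g c` for all `a < c`. -/
noncomputable def spacing (b : Ordinal.{u} → Ordinal.{u}) (c : Ordinal.{u}) : Ordinal.{u} :=
  ⨆ a : c.ToType, succ (spacing b a.toOrd + b a.toOrd)
termination_by c
decreasing_by exact a.toOrd.2

theorem spacing_add_lt (b : Ordinal.{u} → Ordinal.{u}) {a c : Ordinal.{u}} (h : a < c) :
    spacing b a + b a < spacing b c := by
  rw [spacing.eq_1 b c]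
  have := Ordinal.le_iSup (fun a : c.ToType => succ (spacing b a.toOrd + b a.toOrd))
    (ToType.mk ⟨a, h⟩)
  refine (lt_succ _).trans_le (le_trans ?_ this)
  simp

theorem spacing_strictMono (b : Ordinal.{u} → Ordinal.{u}) : StrictMono (spacing b) :=
  fun _ _ h => le_self_add.trans_lt (spacing_add_lt b h)

theorem spacing_lt {c : Cardinal.{u}} (hc : c.IsRegular) {b : Ordinal.{u} → Ordinal.{u}}
    (hb : ∀ a < c.ord, b a < c.ord) (a : Ordinal.{u}) : a < c.ord → spacing b a < c.ord := by
  induction a using WellFoundedLT.induction with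
  | ind a ih =>
  intro ha
  rw [spacing]
  refine Ordinal.iSup_lt_of_lt_cof ?_ fun d => ?_
  · rw [hc.cof_ord, mk_toType]
    exact lt_ord.1 ha
  · have hd : (d.toOrd : Ordinal.{u}) < a := d.toOrd.2
    exact (isSuccLimit_ord hc.aleph0_le).succ_lt
      (isPrincipal_add_ord hc.aleph0_le (ih _ hd (hd.trans ha)) (hb _ (hd.trans ha)))

/-- There is only one letter and one word. -/
def unitLetterSystem (i : Ordinal.{u}) : LetterSystem i PUnit.{v + 1} PUnit.{u + 1} where
  read _ _ := ⟨⟩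
  bit _ := True
  word _ _ := ⟨⟩
  read_zero _ _ _ := rfl
  read_eq _ _ _ _ _ := rfl
  glue _ _ _ _ := ⟨⟨⟩, fun _ _ => rfl, fun _ _ => rfl⟩

/-- Position `a` is stretched to an interval of positions, which serve as letters. -/
noncomputable def ordinalLetterCoding {c : Cardinal.{u}} (hc : c.IsRegular)
    {b : Ordinal.{u} → Ordinal.{u}} (hb : ∀ a < c.ord, b a < c.ord) :
    LetterCoding c.ord Ordinal.{u} :=
  have hl : IsSuccLimit c.ord := isSuccLimit_ord hc.aleph0_le
  have hpos : ∀ a < c.ord, ∀ x, spacing b a + min x (b a) < c.ord := fun a ha x =>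
    ((add_le_add_right (min_le_right x (b a)) _).trans_lt
      (spacing_add_lt b (lt_succ a))).trans (spacing_lt hc hb _ (hl.succ_lt ha))
  { height := fun a => 2 * spacing b a
    height_mono := fun _ _ h => mul_le_mul_right ((spacing_strictMono b).monotone h) 2
    le_height := fun _ => (spacing_strictMono b).le_apply.trans (le_mul_of_one_le_left' one_le_two)
    height_lt := fun a ha => LetterSystem.two_mul_lt hl.isSuccPrelimit (spacing_lt hc hb a ha)
    code := fun a x => (unitLetterSystem.{u, u} c.ord).code (spacing b a + min x (b a)) ⟨⟩
    -- Capping at `b a` keeps the code of every ordinal within the interval reserved for position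
    -- `a`, and is harmless for letters below `b a`.
    read := fun a x => min x (b a)
    eqvAt := fun a d had hd x y =>
      ((unitLetterSystem c.ord).eqvAt_code (spacing b a) _ le_self_add
        (hpos a (had.trans_lt hd) x) ⟨⟩ ⟨⟩).symm.trans
      ((unitLetterSystem c.ord).eqvAt_code (spacing b a) _
        (((spacing_strictMono b).monotone had).trans le_self_add) (hpos d hd y) ⟨⟩ ⟨⟩)
    eq_of_eqvAt := fun a d e hae hd he x y h => by
      have key : ∀ a d : Ordinal.{u}, ∀ x y, a < d →
          spacing b a + min x (b a) ≠ spacing b d + min y (b d) := fun a d x y h =>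
        ((add_le_add_right (min_le_right x (b a)) _).trans_lt
          ((spacing_add_lt b h).trans_le le_self_add)).ne
      have h1 := (((unitLetterSystem.{u, u} c.ord).letterCoding hl.isSuccPrelimit).eq_of_eqvAt
        _ _ (spacing b e) ((add_le_add_right (min_le_right x (b a)) _).trans_lt
          (spacing_add_lt b hae)) (hpos d hd y) (spacing_lt hc hb e he) ⟨⟩ ⟨⟩ h).1
      rcases lt_trichotomy a d with hlt | rfl | hlt
      · exact absurd h1 (key _ _ _ _ hlt)
      · exact ⟨rfl, add_left_cancel h1⟩
      · exact absurd h1.symm (key _ _ _ _ hlt) }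

/-- A node of a branchless tidy tree is read as the word of its restrictions, each level being
enumerated by ordinals below its size. These sizes are below `c`, so stretching every position by
the size of its level remains below `c` by regularity. -/
theorem exists_no_successor_of_not_hasTreeProperty {κ : WithTop Cardinal.{u}} {c : Cardinal.{u}}
    (hc : c.IsRegular) (htree : ¬ HasTreeProperty c)
    (hκ : ∀ d : Cardinal.{u}, κ = d → ℵ₀ ≤ d ∧ c ≤ d)
    (hl : IsSuccPrelimit c.ord) (h0 : 0 < c.ord) :
    ∃ a ∈ level κ c.ord, (sect hl a 0 h0).Nonempty ∧ ∀ b ∈ level ⊤ c.ord,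
      ¬ ∀ (k : Ordinal.{u}) (hk : k < c.ord), preConn c.ord k hk.le b ∈ sect hl a k hk := by
  classical
  simp only [HasTreeProperty, not_forall] at htree
  obtain ⟨D, hD, hs, hno⟩ := htree
  let b : Ordinal.{u} → Ordinal.{u} := fun a =>
    if h : a < c.ord then (#(D.obj ⟨a, h⟩)).ord else 0
  have hba : ∀ i : Set.Iio c.ord, b i = (#(D.obj i)).ord := fun i => dif_pos i.2
  have hb : ∀ a < c.ord, b a < c.ord := fun a ha => by
    rw [hba ⟨a, ha⟩]
    exact ord_lt_ord.2 (hs _)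
  have hr : ∀ i : Set.Iio c.ord, ∃ r : D.obj i → Ordinal.{u}, Function.Injective r ∧
      ∀ x, r x < b i := fun i => by
    obtain ⟨e⟩ := Cardinal.eq.1 (mk_ord_toType #(D.obj i)).symm
    refine ⟨fun x => (e x).toOrd, ?_, fun x => ?_⟩
    · exact Subtype.val_injective.comp (ToType.mk.symm.injective.comp e.injective)
    · rw [hba]
      exact (e x).toOrd.2
  choose r hrinj hrb using hr
  have hne : ∀ i, Nonempty (D.obj i) := fun i => by
    obtain ⟨o, ho, ⟨x⟩⟩ := hD.root
    obtain ⟨y, -⟩ := hD.surjective o i (ho i) x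
    exact ⟨y⟩
  let T : BranchlessTree c.ord Ordinal.{u} (ordinalLetterCoding hc hb).read :=
    { node := D.obj
      word := fun i x m => if h : m ≤ i.1 then
        r ⟨m, h.trans_lt i.2⟩ (D.map (j := ⟨m, h.trans_lt i.2⟩) (i := i) h x) else 0
      nonempty := hne
      restrict := fun i j hij x => ⟨D.map hij x, fun m hm => by
        have hmj : m ≤ j.1 := hm.le.trans hij
        simp only [dif_pos hm.le, dif_pos hmj, D.map_comp]⟩
      extend := fun i j hij y => by
        obtain ⟨x, rfl⟩ := hD.surjective i j hij y
        refine ⟨x, fun m hm => ?_⟩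
        have hmj : m ≤ j.1 := hm.le.trans hij
        simp only [dif_pos hm.le, dif_pos hmj, D.map_comp]
      no_branch := by
        rintro ⟨q, hq⟩
        choose t ht using hq
        have hsucc : ∀ i : Set.Iio c.ord, succ i.1 < c.ord := fun i =>
          (isSuccLimit_ord hc.aleph0_le).succ_lt i.2
        let s : Set.Iio c.ord → Set.Iio c.ord := fun i => ⟨succ i.1, hsucc i⟩
        have his : ∀ i, i ≤ s i := fun i => le_succ i.1
        -- A node at `i` is tested only on letters strictly below `i`; going up to `succ j` makes
        -- the letter at `i ≤ j` available. Its value then no longer depends on `j`, which makes the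
        -- restrictions a branch.
        have hqr : ∀ i j (hij : i ≤ j), r i (D.map (hij.trans (his j)) (t (s j))) =
            min (q i) (b i) := by
          intro i j hij
          have h1 := ht (s j) i.1 (lt_succ_iff.2 hij)
          have h2 : i.1 ≤ (s j).1 := hij.trans (his j)
          rw [dif_pos h2] at h1
          exact ((min_eq_left (hrb i _).le).symm.trans h1.symm)
        refine hno ⟨fun i => D.map (his i) (t (s i)), fun i j hij => hrinj i ?_⟩
        rw [D.map_comp, hqr i j hij, ← hqr i i le_rfl] }
  refine T.exists_no_successor hl h0 (fun d hd => ord_le_ord.2 (hκ d hd).2) _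
    (fun m hm x => ?_) fun d a hd => (hs a).trans_le (hκ d hd).2
  refine (unitLetterSystem c.ord).projectsInto_code (fun d hd => ⟨(hκ d hd).1,
    ord_le_ord.2 (hκ d hd).2, ?_⟩) _ ?_ _
  · rw [mk_punit]
    exact one_lt_aleph0.trans_le (hκ d hd).1
  · exact ((add_le_add_right (min_le_right x (b m)) _).trans_lt
      (spacing_add_lt b (lt_succ m))).trans
      (spacing_lt hc hb _ ((isSuccLimit_ord hc.aleph0_le).succ_lt hm))

/-! ## Trees without branches at limits that are not strongly inaccessible -/

/-- Sets of ordinals below the initial ordinal of an infinite cardinal `m`, any two of which differ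
at arbitrarily large places. -/
theorem exists_separating_sets {m : Cardinal.{u}} (hm : ℵ₀ ≤ m) {Γ : Type u} (hΓ : #Γ ≤ 2 ^ m) :
    ∃ A : Γ → Set Ordinal.{u}, ∀ x y, ∀ k < m.ord,
      (∀ n, k ≤ n → n < m.ord → (n ∈ A x ↔ n ∈ A y)) → x = y := by
  have hM : #m.ord.ToType = m := mk_ord_toType m
  obtain ⟨φ⟩ : Nonempty (Γ ↪ Set m.ord.ToType) := by
    rw [← Cardinal.le_def, mk_set, hM]
    exact hΓ
  -- The pairing records membership of each `p` at `m` many places `e (p, q)`, and so at places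
  -- beyond any `k < m.ord`.
  obtain ⟨e⟩ : Nonempty (m.ord.ToType × m.ord.ToType ≃ m.ord.ToType) := by
    rw [← Cardinal.eq, mk_prod, Cardinal.lift_id, hM, mul_eq_self hm]
  refine ⟨fun x => {n | ∃ p ∈ φ x, ∃ q, ((e (p, q)).toOrd : Ordinal.{u}) = n},
    fun x y k hk h => φ.injective (Set.ext fun p => ?_)⟩
  obtain ⟨q, hq⟩ : ∃ q, k ≤ (e (p, q)).toOrd := by
    by_contra! hlt
    have : #m.ord.ToType ≤ #k.ToType := mk_le_of_injective
      (f := fun q => ToType.mk ⟨(e (p, q)).toOrd.1, hlt q⟩) fun q q' hqq => by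
        have h1 := congrArg Subtype.val (ToType.mk.injective hqq)
        have h2 := e.injective (ToType.mk.symm.injective (Subtype.val_injective h1))
        exact (Prod.mk.inj h2).2
    rw [hM, mk_toType] at this
    exact (lt_ord.1 hk).not_ge this
  have key : ∀ z, ((e (p, q)).toOrd : Ordinal.{u}) ∈
      {n : Ordinal.{u} | ∃ p ∈ φ z, ∃ q, ((e (p, q)).toOrd : Ordinal.{u}) = n} ↔ p ∈ φ z := by
    intro z
    constructor
    · rintro ⟨p', hp', q', h'⟩
      have h2 := e.injective (ToType.mk.symm.injective (Subtype.val_injective h'))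
      rwa [← (Prod.mk.inj h2).1]
    · exact fun hp => ⟨p, hp, q, rfl⟩
  rw [← key x, ← key y]
  exact h _ hq (e (p, q)).toOrd.2

open Classical in
/-- The reading of letters: below `μ` a letter is read as a bit. -/
noncomputable def bitRead {Γ : Type u} (μ : Ordinal.{u}) (A : Γ → Set Ordinal.{u}) (x₀ : Γ)
    (n : Ordinal.{u}) (x : Γ ⊕ Bool) : Γ ⊕ Bool :=
  if n < μ then .inr (x.elim (fun y => decide (n ∈ A y)) id) else .inl (x.elim id fun _ => x₀)

open Classical in
/-- The word with finitely many changes of letters, described by a list of positions and letters. -/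
noncomputable def listWord {i : Ordinal.{u}} {E : Type u} (d : E) :
    List (i.ToType × E) → Ordinal.{u} → E
  | [], _ => d
  | p :: l, n => if n < p.1.toOrd then listWord d l n else p.2

/-- The words with finitely many changes of letters. -/
noncomputable def listLetterSystem (i : Ordinal.{u}) {Γ : Type u} {μ : Ordinal.{u}} (hμ : 0 < μ)
    {A : Γ → Set Ordinal.{u}}
    (hA : ∀ x y, ∀ k < μ, (∀ n, k ≤ n → n < μ → (n ∈ A x ↔ n ∈ A y)) → x = y) (x₀ : Γ) :
    LetterSystem i (Γ ⊕ Bool) (List (i.ToType × (Γ ⊕ Bool))) where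
  read := bitRead μ A x₀
  bit x := bitRead μ A x₀ 0 x = .inr true
  word := listWord (.inr false)
  read_zero x y h := by
    simp only [bitRead, if_pos hμ] at h ⊢
    simp only [Sum.inr.injEq] at h ⊢
    exact Bool.eq_iff_iff.2 h
  read_eq k hk x y := by
    rintro ⟨m, hmk, h⟩
    -- Bits are recovered from bits below `μ`, and full letters from full letters above `μ`. The
    -- transition is at `k = μ`, where a letter is recovered from its bits at late positions by the
    -- separating property of `A`.
    rcases lt_or_ge k μ with hkμ | hkμ
    · have := h m le_rfl hmk
      simpa only [bitRead, if_pos hkμ, if_pos (hmk.trans hkμ), Sum.elim_inr, id] using this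
    · simp only [bitRead, if_neg hkμ.not_gt, Sum.elim_inl, id, Sum.inl.injEq] at h ⊢
      rcases hkμ.eq_or_lt with rfl | hlt
      · refine hA _ _ m hmk fun n hmn hn => ?_
        have := h n hmn hn
        rw [if_pos hn, if_pos hn, Sum.inr.injEq] at this
        simpa using this
      · have := h (max m μ) (le_max_left _ _) (max_lt hmk hlt)
        rwa [if_neg (le_max_right _ _).not_gt, if_neg (le_max_right _ _).not_gt,
          Sum.inl.injEq] at this
  glue l m hm x := by
    refine ⟨(ToType.mk ⟨m, hm⟩, x) :: l, fun n hn => ?_, fun n hn => ?_⟩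
    · rw [listWord, if_pos (by simpa using hn)]
    · rw [listWord, if_neg (by simpa using hn)]

section Next

variable {Γ : Type u} [LinearOrder Γ] [WellFoundedLT Γ] (f : Γ → Ordinal.{u})

open Classical in
/-- The least letter `x` in the list `F` such that `f x` exceeds `m`. -/
noncomputable def nextLetter (F : List Γ) (m : Ordinal.{u}) : Γ ⊕ Bool :=
  if h : ∃ x, x ∈ F ∧ m < f x then .inl (wellFounded_lt.min {x | x ∈ F ∧ m < f x} h)
  else .inr false

theorem nextLetter_eq {F : List Γ} {m : Ordinal.{u}} {x : Γ} (hx : x ∈ F) (hmx : m < f x)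
    (hmin : ∀ y ∈ F, m < f y → x ≤ y) : nextLetter f F m = .inl x := by
  have h : ∃ x, x ∈ F ∧ m < f x := ⟨x, hx, hmx⟩
  rw [nextLetter, dif_pos h]
  have h1 := wellFounded_lt.min_mem {x | x ∈ F ∧ m < f x} h
  exact congrArg _ (le_antisymm (not_lt.1 (wellFounded_lt.not_lt_min {x | x ∈ F ∧ m < f x} ⟨hx, hmx⟩))
    (hmin _ h1.1 h1.2))

theorem exists_nextLetter_eq {F : List Γ} {m : Ordinal.{u}} (h : ∃ x ∈ F, m < f x) :
    ∃ x ∈ F, m < f x ∧ (∀ y ∈ F, m < f y → x ≤ y) ∧ nextLetter f F m = .inl x := by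
  have h' : {x | x ∈ F ∧ m < f x}.Nonempty := h
  have h1 := wellFounded_lt.min_mem _ h'
  have h2 : ∀ y ∈ F, m < f y → wellFounded_lt.min _ h' ≤ y := fun y hy hmy =>
    not_lt.1 (wellFounded_lt.not_lt_min {x | x ∈ F ∧ m < f x} ⟨hy, hmy⟩)
  exact ⟨_, h1.1, h1.2, h2, nextLetter_eq f h1.1 h1.2 h2⟩

end Next

/-- Words that jump through finitely many places, each letter announcing the place of the next
jump. -/
noncomputable def jumpTree {i : Ordinal.{u}} (hi : IsSuccPrelimit i) (hω : ¬ IsOmegaCofinal i)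
    {Γ : Type u} [LinearOrder Γ] [WellFoundedLT Γ] {f : Γ → Ordinal.{u}} (hf : Monotone f)
    (hfi : ∀ x, f x < i) (hcof : ∀ a < i, ∃ x, a ≤ f x) {μ : Ordinal.{u}} (hμi : μ < i)
    (A : Γ → Set Ordinal.{u}) (x₀ : Γ) : BranchlessTree i (Γ ⊕ Bool) (bitRead μ A x₀) where
  node a := {F : List Γ // ∃ x ∈ F, a.1 ≤ f x}
  word _ F := nextLetter f F.1
  nonempty a := by
    obtain ⟨x, hx⟩ := hcof a.1 a.2
    exact ⟨⟨[x], x, by simp, hx⟩⟩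
  restrict a b hab F := by
    obtain ⟨F, x, hx, hbx⟩ := F
    exact ⟨⟨F, x, hx, le_trans hab hbx⟩, fun _ _ => rfl⟩
  extend a b hab F := by
    classical
    obtain ⟨F, v, hv, hav⟩ := F
    obtain ⟨z, hz⟩ := hcof b.1 b.2
    -- For `m < a` the next letter is at most `v`, so adding a letter not below `v` to reach level
    -- `b` changes nothing there.
    refine ⟨⟨max z v :: F.filter (· ≤ v), max z v, by simp, hz.trans (hf (le_max_left _ _))⟩,
      fun m hm => ?_⟩
    obtain ⟨x, hx, hmx, hmin, h⟩ := exists_nextLetter_eq f ⟨v, hv, hm.trans_le hav⟩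
    have hxv : x ≤ v := hmin v hv (hm.trans_le hav)
    rw [h]
    refine (nextLetter_eq f ?_ hmx fun y hy hmy => ?_).symm
    · simp [hx, hxv]
    · rcases List.mem_cons.1 hy with rfl | hy
      · exact hxv.trans (le_max_right _ _)
      · exact hmin y (List.mem_filter.1 hy).1 hmy
  no_branch := by
    rintro ⟨q, hq⟩
    have hread : ∀ n, μ ≤ n → ∀ x, bitRead μ A x₀ n (.inl x) = .inl x := fun n hn x => by
      simp [bitRead, hn.not_gt]
    have step : ∀ n : {n // μ ≤ n ∧ n < i}, ∃ x, bitRead μ A x₀ n.1 (q n.1) = .inl x ∧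
        n.1 < f x := by
      rintro ⟨n, hn, hni⟩
      obtain ⟨⟨F, y, hy, hny⟩, hF⟩ := hq ⟨succ n, hi.succ_lt hni⟩
      obtain ⟨x, hx, hnx, -, h⟩ := exists_nextLetter_eq f ⟨y, hy, (lt_succ n).trans_le hny⟩
      refine ⟨x, ?_, hnx⟩
      rw [hF n (lt_succ n), h, hread n hn]
    choose x hx hxf using step
    -- A branch is followed from jump to jump, starting at `μ`, from where letters are read
    -- faithfully.
    let s : ℕ → {n // μ ≤ n ∧ n < i} := fun k =>
      Nat.rec ⟨μ, le_rfl, hμi⟩ (fun _ n => ⟨f (x n), n.2.1.trans (hxf n).le, hfi _⟩) k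
    have hs : StrictMono fun k => (s k).1 := strictMono_nat_of_lt_succ fun k => hxf (s k)
    -- As `i` is not ω-cofinal, the jumps are bounded below `i`. A single finite list at level `d +
    -- 1` must then contain all of the infinitely many distinct letters.
    obtain ⟨d, hd, hdi⟩ : ∃ d, (∀ k, (s k).1 ≤ d) ∧ d < i := by
      by_contra! hcon
      refine hω ⟨fun k => (s k).1, hs, ?_, fun d hd => ?_⟩
      · rintro _ ⟨k, rfl⟩
        exact (s k).2.2.le
      · exact hcon d fun k => hd ⟨k, rfl⟩
    obtain ⟨⟨F, y, hy, hdy⟩, hF⟩ := hq ⟨succ d, hi.succ_lt hdi⟩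
    have hmem : ∀ k, x (s k) ∈ F := by
      intro k
      obtain ⟨z, hz, -, -, h⟩ := exists_nextLetter_eq f (F := F) (m := (s k).1)
        ⟨y, hy, (lt_succ_of_le (hd k)).trans_le hdy⟩
      have h1 := hF (s k).1 (lt_succ_of_le (hd k))
      rw [hx, h, hread _ (s k).2.1, Sum.inl.injEq] at h1
      rwa [h1]
    have hinj : Function.Injective fun k => x (s k) := by
      intro k k' h
      have : (s (k + 1)).1 = (s (k' + 1)).1 := congrArg f h
      exact Nat.succ_injective (hs.injective this)
    exact (Set.infinite_range_of_injective hinj) ((List.finite_toSet F).subset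
      (by rintro _ ⟨k, rfl⟩; exact hmem k))

/-- The letters come from a cofinal set of size `i.cof`, which the bound `2 ^ m` allows to be
separated by subsets of `m.ord`. Words and nodes are given by finite lists, and strictness of `i <
c.ord` keeps their number below `c`. -/
theorem exists_no_successor_of_cof_le_two_power {κ : WithTop Cardinal.{u}} {i : Ordinal.{u}}
    (hi : IsSuccPrelimit i) (h0 : 0 < i) (hω : ¬ IsOmegaCofinal i)
    (hκ : ∀ c : Cardinal.{u}, κ = c → i < c.ord) {m : Cardinal.{u}} (hm : ℵ₀ ≤ m)
    (hmi : m.ord < i) (hcof : i.cof ≤ 2 ^ m) :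
    ∃ a ∈ level κ i, (sect hi a 0 h0).Nonempty ∧
      ∀ b ∈ level ⊤ i, ¬ ∀ (k : Ordinal.{u}) (hk : k < i), preConn i k hk.le b ∈ sect hi a k hk := by
  obtain ⟨S, hS, hSc⟩ := Order.exists_cof_eq i.ToType
  rw [cof_toType] at hSc
  obtain ⟨A, hA⟩ := exists_separating_sets hm (hSc.trans_le hcof)
  let f : S → Ordinal.{u} := fun x => x.1.toOrd
  have hf : Monotone f := fun x y h => (ToType.mk (o := i)).symm.monotone h
  have hfi : ∀ x, f x < i := fun x => x.1.toOrd.2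
  have hfc : ∀ a < i, ∃ x, a ≤ f x := fun a ha => by
    obtain ⟨y, hy, hay⟩ := hS (ToType.mk ⟨a, ha⟩)
    refine ⟨⟨y, hy⟩, ?_⟩
    have := (ToType.mk (o := i)).symm.monotone hay
    rwa [OrderIso.symm_apply_apply] at this
  obtain ⟨x₀, -⟩ := hfc 0 h0
  have hμ : 0 < m.ord := (omega0_pos).trans_le (by rwa [← ord_aleph0, ord_le_ord])
  let L := listLetterSystem i hμ hA x₀
  have hSκ : ∀ c : Cardinal.{u}, κ = c → ℵ₀ < c ∧ #i.ToType < c ∧ #S < c := fun c hc => by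
    have h1 : #i.ToType < c := by rw [mk_toType]; exact lt_ord.1 (hκ c hc)
    exact ⟨hm.trans_lt (ord_lt_ord.1 (hmi.trans (hκ c hc))), h1, (mk_set_le S).trans_lt h1⟩
  refine (jumpTree hi hω hf hfi hfc hmi A x₀).exists_no_successor hi h0
    (fun c hc => (hκ c hc).le) (L.letterCoding hi) (L.projectsInto_code fun c hc => ?_)
    fun c a hc => ?_
  · obtain ⟨h1, h2, h3⟩ := hSκ c hc
    refine ⟨h1.le, (hκ c hc).le, (mk_list_le_max _).trans_lt (max_lt h1 ?_)⟩
    rw [mk_prod, Cardinal.lift_id, Cardinal.lift_id, mk_sum]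
    refine mul_lt_of_lt h1.le h2 (add_lt_of_lt h1.le (by simpa using h3) ?_)
    exact (Cardinal.lift_lt_aleph0.2 (lt_aleph0_of_finite Bool)).trans h1
  · obtain ⟨h1, h2, h3⟩ := hSκ c hc
    exact (mk_subtype_le _).trans_lt ((mk_list_le_max _).trans_lt (max_lt h1 h3))

/-! ## The equivalence -/

/-- A limit above `c.ord` is at least `c.ord + ω`. -/
theorem le_ord_of_not_isExtensible {κ : WithTop Cardinal.{u}} {l : Ordinal.{u}}
    (hl : IsSuccPrelimit l) (h : ¬ IsExtensible κ l) (c : Cardinal.{u}) (hc : κ = c) :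
    l ≤ c.ord := by
  by_contra! hlt
  refine h ⟨hl, .inr (.inr (.inr (.inl ⟨c, hc, ?_⟩)))⟩
  refine (add_le_iff_of_isSuccLimit isSuccLimit_omega0).2 fun d hd => ?_
  obtain ⟨n, rfl⟩ := lt_omega0.1 hd
  exact (hl.add_natCast_lt hlt n).le

/-- If the cofinality of `l` exceeds the power sets of all smaller cardinals, then `l` is a strongly
inaccessible cardinal. -/
theorem isStronglyInaccessible_cof {l : Ordinal.{u}} (hl : IsSuccLimit l)
    (h : ∀ m : Cardinal.{u}, ℵ₀ ≤ m → m.ord < l → 2 ^ m < l.cof) :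
    IsStronglyInaccessible l.cof ∧ l = l.cof.ord := by
  have hcof : ℵ₀ ≤ l.cof := (isRegular_cof hl).aleph0_le
  have e : l = l.cof.ord := by
    -- If `l` exceeded its cofinality, the hypothesis for `m = l.cof` would contradict Cantor's
    -- theorem.
    refine le_antisymm (not_lt.1 fun hlt => ?_) (ord_cof_le l)
    exact (cantor l.cof).not_gt (h _ hcof hlt)
  refine ⟨⟨isRegular_cof hl, fun A hA => ?_⟩, e⟩
  rw [mk_set]
  rcases lt_or_ge #A ℵ₀ with hfin | hinf
  · exact (power_lt_aleph0 (natCast_lt_aleph0 (n := 2)) hfin).trans_le hcof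
  · exact h _ hinf ((ord_lt_ord.2 hA).trans_eq e.symm)

theorem exists_no_successor_of_not_isExtensible {κ : WithTop Cardinal.{u}}
    (hκ : IsInfiniteRegular κ) {l : Ordinal.{u}} (hl : IsSuccPrelimit l)
    (h : ¬ IsExtensible κ l) : ∃ h0 : 0 < l, ∃ a ∈ level κ l, (sect hl a 0 h0).Nonempty ∧
      ∀ b ∈ level ⊤ l, ¬ ∀ (k : Ordinal.{u}) (hk : k < l), preConn l k hk.le b ∈ sect hl a k hk := by
  have hle := le_ord_of_not_isExtensible hl h
  simp only [IsExtensible, hl, true_and, not_or] at h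
  obtain ⟨hne, hω, hwc, -, hreg⟩ := h
  have h0 : 0 < l := pos_iff_ne_zero.2 hne
  refine ⟨h0, ?_⟩
  -- The case `l = κ` is separate because the jump tree needs `l < κ`; there regularity of `κ` and
  -- failure of its tree property suffice.
  by_cases hcase : ∃ c : Cardinal.{u}, κ = c ∧ l = c.ord
  · obtain ⟨c, hc, rfl⟩ := hcase
    refine exists_no_successor_of_not_hasTreeProperty (hκ c hc)
      (fun ht => hreg ⟨c, hc, ht, rfl⟩) (fun d hd => ?_) hl h0
    exact ⟨(hκ d hd).aleph0_le, ord_le_ord.1 (hle d hd)⟩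
  · have hlt : ∀ c : Cardinal.{u}, κ = c → l < c.ord := fun c hc =>
      (hle c hc).lt_of_ne fun e => hcase ⟨c, hc, e⟩
    by_cases hm : ∃ m : Cardinal.{u}, ℵ₀ ≤ m ∧ m.ord < l ∧ l.cof ≤ 2 ^ m
    · obtain ⟨m, hm, hml, hcof⟩ := hm
      exact exists_no_successor_of_cof_le_two_power hl h0 hω hlt hm hml hcof
    · push Not at hm
      obtain ⟨hinacc, e⟩ := isStronglyInaccessible_cof
        ⟨not_isMin_iff_ne_bot.2 hne, hl⟩ hm
      generalize l.cof = c at hinacc e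
      subst e
      exact exists_no_successor_of_not_hasTreeProperty hinacc.1
        (fun ht => hwc ⟨c, ⟨hinacc, ht⟩, rfl⟩)
        (fun d hd => ⟨(hκ d hd).aleph0_le, ord_le_ord.1 (hle d hd)⟩) hl h0

theorem theorem7p11 (κ : WithTop Cardinal.{u}) (hκ : IsInfiniteRegular κ)
    (j i : Ordinal.{u}) (hji : j ≤ i) :
    (∀ a : (finalChain κ).obj i,
      coalgProj FinalChainTrans j ⟨i, finalChainInclusion κ i a⟩ =
        finalChainInclusion κ j ((finalChain κ).map hji a)) ↔
      (j ≤ finitePart i ∨ IsExtensible κ (limitPart i)) := by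
  rw [coalgProj_eq_iff_projAgrees]
  refine projAgrees_iff_of_limit hκ (fun l hl h => ?_) (fun l hl h => ?_) i j hji
  · exact projAgrees_of_hasBranches hl (fun a ha => h.hasBranches hκ hl ha) l le_rfl
  · obtain ⟨h0, a, ha, hne, hno⟩ := exists_no_successor_of_not_isExtensible hκ hl h
    exact ⟨h0.ne', not_projAgrees_one hl ha h0 hne hno⟩
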